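/- Let $\Omega=(0,1)^3$ and let $0=x_0<\dots<x_{M_x}=1$, $0=y_0<\dots<y_{M_y}=1$, $0=z_0<\dots<z_{M_z}=1$ be arbitrary (not necessarily uniform) meshes with steps $h^x_i=x_i-x_{i-1}$ and $\hbar^x_i=\tfrac12(h^x_i+h^x_{i+1})$, similarly in $y$ and $z$. Let $\bar\Omega^h$ be the product mesh, $\Omega^h$ its points in $\Omega$ and $\partial\Omega^h$ its points on $\partial\Omega$. For $(x_i,y_j,z_k)\in\Omega^h$ let $$\omega_{ijk}=\left(x_i-\tfrac{h^x_i}2,\,x_i+\tfrac{h^x_{i+1}}2\right)\times\left(y_j-\tfrac{h^y_j}2,\,y_j+\tfrac{h^y_{j+1}}2\right)\times\left(z_k-\tfrac{h^z_k}2,\,z_k+\tfrac{h^z_{k+1}}2\right),$$ and let $\chi_{ijk}$ be the indicator function of the box $(x_i,y_j,z_k)-\omega_{ijk}$, so that convolution with $\chi_{ijk}$, evaluated at $(x_i,y_j,z_k)$, is integration over $\omega_{ijk}$. For $\sigma\in\mathbb R$, $H^\sigma(\Omega)$ is the space of restrictions to $\Omega$ of the elements of $H^\sigma(\mathbb R^3)$,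 with the quotient norm. For a real distribution $f$ on $\Omega$ put $(\chi_{ijk}*f)(x)=\langle f,\chi_{ijk}(x-\cdot)|_\Omega\rangle$, where $f$ is extended by continuity from test functions on $\Omega$ to the indicator function, which is approached in $H^\tau(\mathbb R^3)$ for every $\tau<1/2$; and $$(T_{111}f)_{ijk}=\frac1{\hbar^x_i\hbar^y_j\hbar^z_k}(\chi_{ijk}*f)(x_i,y_j,z_k).$$ Define $\Delta^-_xv_{ijk}=(v_{ijk}-v_{i-1,j,k})/h^x_i$, $\Delta^+_xv_{ijk}=(v_{i+1,j,k}-v_{ijk})/\hbar^x_i$, $$\mu_{xy}v_{ijk}=\frac{h^x_ih^y_jv_{i-1,j-1,k}+h^x_{i+1}h^y_jv_{i+1,j-1,k}+12\hbar^x_i\hbar^y_jv_{ijk}+h^x_ih^y_{j+1}v_{i-1,j+1,k}+h^x_{i+1}h^y_{j+1}v_{i+1,j+1,k}}{16\,\hbar^x_i\hbar^y_j},$$ and analogously $\Delta^\pm_y,\Delta^\pm_z,\mu_{xz},\mu_{yz}$. The scheme is: find a real mesh function $u^h$ on $\bar\Omega^h$ with $$-2\left(\Delta^+_x\Delta^-_x\mu_{yz}+\Delta^+_y\Delta^-_y\mu_{xz}+\Delta^+_z\Delta^-_z\mu_{xy}\right)u^h=T_{111}f\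 \text{ in }\Omega^h,\qquad u^h=0\ \text{ on }\partial\Omega^h.\qquad(*)$$ Let $(v,w)=\sum_{i=1}^{M_x-1}\sum_{j=1}^{M_y-1}\sum_{k=1}^{M_z-1}\hbar^x_i\hbar^y_j\hbar^z_kv_{ijk}w_{ijk}$ and $\|v\|_{1,h}^2=(v,v)+\|\Delta^-_xv\|_x^2+\|\Delta^-_yv\|_y^2+\|\Delta^-_zv\|_z^2$, where $\|v\|_x^2=\sum_{i=1}^{M_x}\sum_{j=1}^{M_y-1}\sum_{k=1}^{M_z-1}h^x_i\hbar^y_j\hbar^z_kv_{ijk}^2$ and $\|\cdot\|_y,\|\cdot\|_z$ are analogous. Let $\|v\|_{-1,h}=\sup_w|(v,w)|/\|w\|_{1,h}$, the supremum being over all non-zero mesh functions $w$ on $\bar\Omega^h$ that vanish on $\partial\Omega^h$ (it is $0$ if there are none). **Theorem.** Let $\sigma>-1/2$. (a) For every real $f\in H^\sigma(\Omega)$ and every $(x_i,y_j,z_k)\in\Omega^h$ the convolution $\chi_{ijk}*f$ is well defined at each point of $\mathbb R^3$ and is a continuous function on $\mathbb R^3$; moreover $T_{111}$ is linear on $H^\sigma(\Omega)$,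 and there is a constant $C$, depending only on $\sigma$ and the mesh, with $\sup_{x\in\mathbb R^3}|(\chi_{ijk}*f)(x)|\le C\|f\|_{H^\sigma(\Omega)}$ and $|(T_{111}f)_{ijk}|\le C\|f\|_{H^\sigma(\Omega)}$ for all such $f$ and all $(x_i,y_j,z_k)\in\Omega^h$, so that $T_{111}$ is a continuous operator. (b) For every real $f\in H^\sigma(\Omega)$ the problem $(*)$ has exactly one solution $u^h$, and $$\|u^h\|_{1,h}\le\frac{32}{30}\,\|T_{111}f\|_{-1,h}.$$ -/

import Mathlib

open MeasureTheory Filter TopologicalSpace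
open scoped Distributions SchwartzMap Topology ENNReal NNReal ContDiff

noncomputable section

namespace FiniteVolume

/-! ### Sobolev spaces on the unit cube -/

/-- Three-dimensional Euclidean space. -/
abbrev E3 : Type := EuclideanSpace ℝ (Fin 3)

/-- The open unit cube `Ω = (0,1) × (0,1) × (0,1)`. -/
def unitCube : Opens E3 where
  carrier := {x | ∀ l, 0 < x l ∧ x l < 1}
  is_open' := by
    have h : {x : E3 | ∀ l, 0 < x l ∧ x l < 1} = ⋂ l, {x : E3 | 0 < x l ∧ x l < 1} := by
      ext x; simp
    rw [h]
    refine isOpen_iInter_of_finite fun l => ?_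
    have hc : Continuous fun x : E3 => x l := by fun_prop
    exact (isOpen_lt continuous_const hc).inter (isOpen_lt hc continuous_const)

/-- A real test function on the cube, seen as a complex-valued Schwartz function on `ℝ³`. -/
def testToSchwartz (φ : 𝓓(unitCube, ℝ)) : 𝓢(E3, ℂ) :=
  HasCompactSupport.toSchwartzMap (f := fun x => (φ x : ℂ))
    (φ.hasCompactSupport.comp_left (g := ((↑) : ℝ → ℂ)) Complex.ofReal_zero)
    (Complex.ofRealCLM.contDiff.comp φ.contDiff)

/-- The norm of `H^s(ℝ³)` of a tempered distribution (`∞` if it is not in `H^s(ℝ³)`):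
the `L²` norm of its Bessel potential of order `s`. -/
def sobolevNorm (s : ℝ) (F : 𝓢'(E3, ℂ)) : ℝ≥0∞ :=
  ⨅ (g : Lp ℂ 2 (volume : Measure E3))
    (_ : TemperedDistribution.besselPotential E3 ℂ s F = (g : 𝓢'(E3, ℂ))), ‖g‖ₑ

/-- `f` is the restriction of `F` to the cube. -/
def IsRestriction (F : 𝓢'(E3, ℂ)) (f : 𝓓'(unitCube, ℝ)) : Prop :=
  ∀ φ : 𝓓(unitCube, ℝ), F (testToSchwartz φ) = (f φ : ℂ)

/-- `f ∈ H^s(Ω)`: the real distribution `f` on the cube is the restriction of an element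
of `H^s(ℝ³)`. -/
def MemSobolevCube (s : ℝ) (f : 𝓓'(unitCube, ℝ)) : Prop :=
  ∃ F : 𝓢'(E3, ℂ), TemperedDistribution.MemSobolev s 2 F ∧ IsRestriction F f

/-- The norm of `H^s(Ω)`: the infimum of the `H^s(ℝ³)` norms of all extensions. -/
def sobolevNormCube (s : ℝ) (f : 𝓓'(unitCube, ℝ)) : ℝ≥0∞ :=
  ⨅ (F : 𝓢'(E3, ℂ)) (_ : IsRestriction F f), sobolevNorm s F

/-! ### Convolution of a distribution on the cube with the indicator of a set -/

instance hasTemperateGrowth_restrict (A : Set E3) :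
    ((volume : Measure E3).restrict A).HasTemperateGrowth := by
  obtain ⟨n, hn⟩ := Measure.HasTemperateGrowth.exists_integrable (μ := (volume : Measure E3))
  exact ⟨⟨n, hn.restrict⟩⟩

/-- The indicator function of `A`, as the tempered distribution `φ ↦ ∫_A φ`. -/
def indicatorDistribution (A : Set E3) : 𝓢'(E3, ℂ) :=
  ((volume : Measure E3).restrict A).toTemperedDistribution

/-- Convergence of test functions on the cube to the indicator function of `A` in
`H^τ(ℝ³)` for every `τ < 1/2`. -/
def toIndicator (A : Set E3) : Filter 𝓓(unitCube, ℝ) :=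
  ⨅ (τ : ℝ) (_ : τ < 1 / 2), comap
    (fun φ => sobolevNorm τ ((testToSchwartz φ : 𝓢'(E3, ℂ)) - indicatorDistribution A)) (𝓝 0)

/-- The duality pairing `⟨f, 1_A⟩` exists and equals `c`: the extension of `f` by continuity
from test functions to the indicator function of `A ⊆ Ω`. -/
def HasPairing (f : 𝓓'(unitCube, ℝ)) (A : Set E3) (c : ℝ) : Prop :=
  Tendsto (fun φ => f φ) (toIndicator A) (𝓝 c)

/-- The set of all `y ∈ Ω` with `x - y ∈ K`, that is the set on which the function
`y ↦ 1_K (x - y)` on `Ω` is one. -/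
def convSet (K : Set E3) (x : E3) : Set E3 := {y | y ∈ unitCube ∧ x - y ∈ K}

/-- The convolution `(1_K * f)(x) = ⟨f, 1_K (x - ·)⟩`, where `f` is a distribution on `Ω`
(so that the pairing is over `Ω`). -/
def indicatorConv (K : Set E3) (f : 𝓓'(unitCube, ℝ)) (x : E3) : ℝ :=
  limUnder (toIndicator (convSet K x)) (fun φ => f φ)

/-! ### Meshes -/

/-- A mesh `0 = pt 0 < pt 1 < ⋯ < pt M = 1` of the unit interval; the values `pt i` with
`i > M` play no role. -/
structure Mesh1 where
  M : ℕ
  pt : ℕ → ℝ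
  pt_zero : pt 0 = 0
  pt_last : pt M = 1
  pt_lt : ∀ i < M, pt i < pt (i + 1)

/-- The step `h_i = pt i - pt (i-1)`, for `1 ≤ i ≤ M`. -/
def Mesh1.h (m : Mesh1) (i : ℕ) : ℝ := m.pt i - m.pt (i - 1)

/-- The averaged step `(h_i + h_{i+1}) / 2`, for `1 ≤ i ≤ M - 1`. -/
def Mesh1.hbar (m : Mesh1) (i : ℕ) : ℝ := (m.h i + m.h (i + 1)) / 2

/-- The one-dimensional cell `(pt i - h_i / 2, pt i + h_{i+1} / 2)`. -/
def Mesh1.cell (m : Mesh1) (i : ℕ) : Set ℝ :=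
  Set.Ioo (m.pt i - m.h i / 2) (m.pt i + m.h (i + 1) / 2)

/-- A Cartesian product mesh of the closed unit cube. -/
structure Mesh where
  x : Mesh1
  y : Mesh1
  z : Mesh1

namespace Mesh

variable (m : Mesh)

/-- `(x_i, y_j, z_k)` is an interior mesh point. -/
def Interior (i j k : ℕ) : Prop :=
  (0 < i ∧ i < m.x.M) ∧ (0 < j ∧ j < m.y.M) ∧ (0 < k ∧ k < m.z.M)

/-- The mesh point `(x_i, y_j, z_k)`. -/
def node (i j k : ℕ) : E3 := !₂[m.x.pt i, m.y.pt j, m.z.pt k]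

/-- The finite volume `ω_ijk`. -/
def cell (i j k : ℕ) : Set E3 :=
  {p | p 0 ∈ m.x.cell i ∧ p 1 ∈ m.y.cell j ∧ p 2 ∈ m.z.cell k}

/-- The set whose indicator function is the convolution kernel of the cell `ω_ijk`: `p` is in
it if and only if `(x_i, y_j, z_k) - p` is in `ω_ijk`. Hence the convolution of a function with
this kernel, taken at the mesh point `(x_i, y_j, z_k)`, is the integral over `ω_ijk`. -/
def kernel (i j k : ℕ) : Set E3 := {p | m.node i j k - p ∈ m.cell i j k}

/-- The cell averages `T₁₁₁ f` (used at interior mesh points). -/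
def T111 (f : 𝓓'(unitCube, ℝ)) (i j k : ℕ) : ℝ :=
  1 / (m.x.hbar i * m.y.hbar j * m.z.hbar k) *
    indicatorConv (m.kernel i j k) f (m.node i j k)

/-! ### Mesh functions and difference operators -/

/-- Real functions on the mesh points, boundary included. -/
abbrev Fn : Type := Fin (m.x.M + 1) → Fin (m.y.M + 1) → Fin (m.z.M + 1) → ℝ

variable {m} in
/-- The values of a mesh function, indexed by natural numbers (zero outside the mesh). -/
def Fn.val (u : m.Fn) (i j k : ℕ) : ℝ :=
  if h : i < m.x.M + 1 ∧ j < m.y.M + 1 ∧ k < m.z.M + 1 then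
    u ⟨i, h.1⟩ ⟨j, h.2.1⟩ ⟨k, h.2.2⟩
  else 0

variable {m} in
/-- The mesh function vanishes at all mesh points on the boundary of the cube. -/
def Fn.VanishesOnBoundary (u : m.Fn) : Prop :=
  ∀ i ≤ m.x.M, ∀ j ≤ m.y.M, ∀ k ≤ m.z.M, ¬ m.Interior i j k → u.val i j k = 0

/-- The averaging operator `μ_xy`. -/
def muXY (v : ℕ → ℕ → ℕ → ℝ) (i j k : ℕ) : ℝ :=
  1 / (16 * m.x.hbar i * m.y.hbar j) *
    (m.x.h i * m.y.h j * v (i - 1) (j - 1) k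
      + m.x.h (i + 1) * m.y.h j * v (i + 1) (j - 1) k
      + 12 * m.x.hbar i * m.y.hbar j * v i j k
      + m.x.h i * m.y.h (j + 1) * v (i - 1) (j + 1) k
      + m.x.h (i + 1) * m.y.h (j + 1) * v (i + 1) (j + 1) k)

/-- The averaging operator `μ_xz`. -/
def muXZ (v : ℕ → ℕ → ℕ → ℝ) (i j k : ℕ) : ℝ :=
  1 / (16 * m.x.hbar i * m.z.hbar k) *
    (m.x.h i * m.z.h k * v (i - 1) j (k - 1)
      + m.x.h (i + 1) * m.z.h k * v (i + 1) j (k - 1)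
      + 12 * m.x.hbar i * m.z.hbar k * v i j k
      + m.x.h i * m.z.h (k + 1) * v (i - 1) j (k + 1)
      + m.x.h (i + 1) * m.z.h (k + 1) * v (i + 1) j (k + 1))

/-- The averaging operator `μ_yz`. -/
def muYZ (v : ℕ → ℕ → ℕ → ℝ) (i j k : ℕ) : ℝ :=
  1 / (16 * m.y.hbar j * m.z.hbar k) *
    (m.y.h j * m.z.h k * v i (j - 1) (k - 1)
      + m.y.h (j + 1) * m.z.h k * v i (j + 1) (k - 1)
      + 12 * m.y.hbar j * m.z.hbar k * v i j k
      + m.y.h j * m.z.h (k + 1) * v i (j - 1) (k + 1)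
      + m.y.h (j + 1) * m.z.h (k + 1) * v i (j + 1) (k + 1))

/-- Backward divided difference in `x`. -/
def dMinusX (v : ℕ → ℕ → ℕ → ℝ) (i j k : ℕ) : ℝ := (v i j k - v (i - 1) j k) / m.x.h i

/-- Backward divided difference in `y`. -/
def dMinusY (v : ℕ → ℕ → ℕ → ℝ) (i j k : ℕ) : ℝ := (v i j k - v i (j - 1) k) / m.y.h j

/-- Backward divided difference in `z`. -/
def dMinusZ (v : ℕ → ℕ → ℕ → ℝ) (i j k : ℕ) : ℝ := (v i j k - v i j (k - 1)) / m.z.h k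

/-- Forward divided difference in `x`. -/
def dPlusX (v : ℕ → ℕ → ℕ → ℝ) (i j k : ℕ) : ℝ := (v (i + 1) j k - v i j k) / m.x.hbar i

/-- Forward divided difference in `y`. -/
def dPlusY (v : ℕ → ℕ → ℕ → ℝ) (i j k : ℕ) : ℝ := (v i (j + 1) k - v i j k) / m.y.hbar j

/-- Forward divided difference in `z`. -/
def dPlusZ (v : ℕ → ℕ → ℕ → ℝ) (i j k : ℕ) : ℝ := (v i j (k + 1) - v i j k) / m.z.hbar k

/-- `u` solves the finite volume scheme in its finite difference form with data `f`. -/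
def IsSolution (f : 𝓓'(unitCube, ℝ)) (u : m.Fn) : Prop :=
  (∀ i j k, m.Interior i j k →
    -2 * (m.dPlusX (m.dMinusX (m.muYZ u.val)) i j k
        + m.dPlusY (m.dMinusY (m.muXZ u.val)) i j k
        + m.dPlusZ (m.dMinusZ (m.muXY u.val)) i j k) = m.T111 f i j k) ∧
  u.VanishesOnBoundary

/-! ### Discrete norms -/

/-- The discrete `L²` inner product over the interior mesh points. -/
def innerL2 (v w : ℕ → ℕ → ℕ → ℝ) : ℝ :=
  ∑ i ∈ Finset.Ioo 0 m.x.M, ∑ j ∈ Finset.Ioo 0 m.y.M, ∑ k ∈ Finset.Ioo 0 m.z.M,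
    m.x.hbar i * m.y.hbar j * m.z.hbar k * v i j k * w i j k

/-- The inner product `(v, w]_x`, where `i` runs from `1` to `M_x`. -/
def innerX (v w : ℕ → ℕ → ℕ → ℝ) : ℝ :=
  ∑ i ∈ Finset.Ioc 0 m.x.M, ∑ j ∈ Finset.Ioo 0 m.y.M, ∑ k ∈ Finset.Ioo 0 m.z.M,
    m.x.h i * m.y.hbar j * m.z.hbar k * v i j k * w i j k

/-- The inner product `(v, w]_y`, where `j` runs from `1` to `M_y`. -/
def innerY (v w : ℕ → ℕ → ℕ → ℝ) : ℝ :=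
  ∑ i ∈ Finset.Ioo 0 m.x.M, ∑ j ∈ Finset.Ioc 0 m.y.M, ∑ k ∈ Finset.Ioo 0 m.z.M,
    m.x.hbar i * m.y.h j * m.z.hbar k * v i j k * w i j k

/-- The inner product `(v, w]_z`, where `k` runs from `1` to `M_z`. -/
def innerZ (v w : ℕ → ℕ → ℕ → ℝ) : ℝ :=
  ∑ i ∈ Finset.Ioo 0 m.x.M, ∑ j ∈ Finset.Ioo 0 m.y.M, ∑ k ∈ Finset.Ioc 0 m.z.M,
    m.x.hbar i * m.y.hbar j * m.z.h k * v i j k * w i j k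

/-- The discrete `L²` norm. -/
def normL2 (v : ℕ → ℕ → ℕ → ℝ) : ℝ := √(m.innerL2 v v)

/-- The discrete `H¹` seminorm. -/
def seminormH1 (v : ℕ → ℕ → ℕ → ℝ) : ℝ :=
  √(m.innerX (m.dMinusX v) (m.dMinusX v) + m.innerY (m.dMinusY v) (m.dMinusY v)
    + m.innerZ (m.dMinusZ v) (m.dMinusZ v))

/-- The discrete `H¹` norm. -/
def normH1 (v : ℕ → ℕ → ℕ → ℝ) : ℝ := √(m.normL2 v ^ 2 + m.seminormH1 v ^ 2)

/-- The discrete `H⁻¹` norm: the supremum over all non-zero mesh functions that vanish on the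
boundary. By the Cauchy-Schwarz inequality the quotients are bounded by `m.normL2 v`. -/
def normHneg1 (v : ℕ → ℕ → ℕ → ℝ) : ℝ :=
  ⨆ w : {w : m.Fn // w ≠ 0 ∧ w.VanishesOnBoundary},
    |m.innerL2 v w.1.val| / m.normH1 w.1.val

end Mesh

end FiniteVolume

end

namespace FiniteVolume

open TemperedDistribution FourierTransform

/-! Analytic half. The Fourier transform of the indicator of a box is a product of one-dimensional
factors, each bounded and decaying like `1 / |ξ_l|`. For a box in the cube its square is therefore
at most `boxMajorant`, which stays integrable against the weight `(1 + |ξ|²)^s` exactly in the range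
needed, `s < 1/2` (`integrable_weightedMajorant`). Thus such indicators lie in `H^{-σ}` for `σ >
-1/2`, and an element `F` of `H^σ` pairs with them as the integral of the product of two `L²`
functions, the Bessel potentials of orders `σ` and `-σ` (`apply_eq_l2Pairing`). The majorant is the
same for all boxes in the cube and for their mollified approximations, so pointwise convergence of
Fourier transforms upgrades to `H^s` convergence by dominated convergence
(`tendsto_sobolevNorm_sub`). This yields approximating test functions, hence uniqueness of the
pairing. It also yields continuity of the convolution, since the translated cell cut off by the cube
is a box whose corners move continuously. The bound comes from Cauchy-Schwarz and the uniform
majorant.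

Discrete half. Averaging in two variables commutes with differences in the third and is bounded
below by `1/2` as a quadratic form (`sum_mu2_mul_ge`). Summation by parts then gives `|v|₁² ≤ (Lv,
v)` for the operator `L` of the scheme, whose factor `2` cancels the `1/2`. A discrete Friedrichs
inequality with constant `1/6` in each direction gives `‖v‖² ≤ |v|₁² / 18`, so `‖v‖₁² ≤ (19/18) (Lv,
v)`, and `19/18 ≤ 32/30`. Coercivity makes the finite square system injective, hence uniquely
solvable, and testing the dual norm with the solution itself gives the stability bound. -/

/-- The space of square integrable functions on `ℝ³`. -/
abbrev L2 : Type := Lp ℂ 2 (volume : Measure E3)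

/-! ### Bessel potentials and the duality of `H^s` and `H^{-s}` -/

theorem toTemperedDistribution_injective {g h : L2}
    (hgh : (g : 𝓢'(E3, ℂ)) = (h : 𝓢'(E3, ℂ))) : g = h := by
  have hk := Lp.ker_toTemperedDistributionCLM_eq_bot (E := E3) (F := ℂ) (μ := volume) (p := 2)
  rw [LinearMap.ker_eq_bot] at hk
  exact hk hgh

theorem sobolevNorm_eq {s : ℝ} {F : 𝓢'(E3, ℂ)} {g : L2}
    (h : besselPotential E3 ℂ s F = (g : 𝓢'(E3, ℂ))) : sobolevNorm s F = ‖g‖ₑ := by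
  refine le_antisymm (iInf₂_le g h) (le_iInf₂ fun g' h' => ?_)
  rw [toTemperedDistribution_injective (h.symm.trans h')]

theorem sobolevNorm_eq_top {s : ℝ} {F : 𝓢'(E3, ℂ)} (h : ¬ MemSobolev s 2 F) :
    sobolevNorm s F = ⊤ := by
  simp only [sobolevNorm, iInf_eq_top]
  exact fun g hg => absurd ⟨g, hg⟩ h

/-- The two transforms differ by a reflection, under which an even symbol is invariant. This is what
makes the Bessel potential its own transpose. -/
theorem fourier_smulLeftCLM_fourierInv_of_even {m : E3 → ℂ} (hm : m.HasTemperateGrowth)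
    (he : ∀ ξ, m (-ξ) = m ξ) (φ : 𝓢(E3, ℂ)) :
    𝓕 (SchwartzMap.smulLeftCLM ℂ m (𝓕⁻ φ)) = 𝓕⁻ (SchwartzMap.smulLeftCLM ℂ m (𝓕 φ)) := by
  ext x
  rw [SchwartzMap.fourier_coe, SchwartzMap.fourierInv_coe, Real.fourierInv_eq_fourier_comp_neg]
  refine congrArg (fun v : E3 → ℂ => 𝓕 v x) (funext fun ξ => ?_)
  simp [hm, he, SchwartzMap.fourier_coe, SchwartzMap.fourierInv_coe, Real.fourierInv_eq_fourier_neg]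

/-- The bilinear pairing `∫ g h` of square integrable functions. -/
noncomputable def l2Pairing : L2 →L[ℂ] L2 →L[ℂ] ℂ :=
  (ContinuousLinearMap.lsmul ℂ ℂ).flip.lpPairing volume 2 2

theorem l2Pairing_eq_integral (g h : L2) : l2Pairing g h = ∫ x, h x * g x :=
  ContinuousLinearMap.lpPairing_eq_integral _ _ _

/-- The pairing of an element of `H^s` with a Schwartz function, expressed by the Bessel
potentials of order `s` and `-s`. -/
theorem apply_eq_l2Pairing {s : ℝ} {F : 𝓢'(E3, ℂ)} {g h : L2} {φ : 𝓢(E3, ℂ)}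
    (hg : besselPotential E3 ℂ s F = (g : 𝓢'(E3, ℂ)))
    (hh : besselPotential E3 ℂ (-s) (φ : 𝓢'(E3, ℂ)) = (h : 𝓢'(E3, ℂ))) :
    F φ = l2Pairing g h := by
  have hm : (fun x : E3 => (((1 + ‖x‖ ^ 2) ^ (-s / 2) : ℝ) : ℂ)).HasTemperateGrowth := by
    fun_prop
  -- Potentials of opposite orders are inverse to each other; the one recovered here is then moved
  -- onto `φ`.
  have h1 : F = besselPotential E3 ℂ (-s) (g : 𝓢'(E3, ℂ)) := by rw [← hg]; simp
  set ψ := SchwartzMap.fourierMultiplierCLM ℂ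
    (fun x : E3 => (((1 + ‖x‖ ^ 2) ^ (-s / 2) : ℝ) : ℂ)) φ with hψ
  have h2 : h = ψ.toLp 2 := by
    apply toTemperedDistribution_injective
    rw [← hh, Lp.toTemperedDistribution_toLp_eq, besselPotential,
      fourierMultiplierCLM_toTemperedDistributionCLM_eq hm]
  rw [h1, besselPotential, fourierMultiplierCLM_apply_apply,
    fourier_smulLeftCLM_fourierInv_of_even hm (by simp),
    ← SchwartzMap.fourierMultiplierCLM_apply, ← hψ, Lp.toTemperedDistribution_apply,
    l2Pairing_eq_integral, h2]
  apply integral_congr_ae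
  filter_upwards [ψ.coeFn_toLp 2 volume] with x hx
  rw [hx, smul_eq_mul]

/-! ### Sobolev norms of integrable functions -/

/-- The weight of the Sobolev norm of order `s` applied to the Fourier transform of `u`. -/
noncomputable def weightedFourier (s : ℝ) (u : E3 → ℂ) (ξ : E3) : ℂ :=
  (((1 + ‖ξ‖ ^ 2) ^ (s / 2) : ℝ) : ℂ) * 𝓕 u ξ

/-- The tempered distribution `U` is given by the integrable function `u`. -/
def IsRepresentedBy (U : 𝓢'(E3, ℂ)) (u : E3 → ℂ) : Prop :=
  Integrable u ∧ ∀ φ : 𝓢(E3, ℂ), U φ = ∫ x, φ x * u x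

theorem IsRepresentedBy.sub {U V : 𝓢'(E3, ℂ)} {u v : E3 → ℂ} (hU : IsRepresentedBy U u)
    (hV : IsRepresentedBy V v) : IsRepresentedBy (U - V) (u - v) := by
  refine ⟨hU.1.sub hV.1, fun φ => ?_⟩
  have hi : ∀ {w : E3 → ℂ}, Integrable w → Integrable fun x => φ x * w x := fun hw =>
    hw.bdd_mul φ.continuous.aestronglyMeasurable
      (ae_of_all _ fun x => SchwartzMap.norm_le_seminorm ℂ φ x)
  rw [show (U - V) φ = U φ - V φ from rfl, hU.2, hV.2, ← integral_sub (hi hU.1) (hi hV.1)]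
  simp [mul_sub]

theorem IsRepresentedBy.besselPotential_eq {s : ℝ} {U : 𝓢'(E3, ℂ)} {u : E3 → ℂ}
    (hU : IsRepresentedBy U u) (hw : MemLp (weightedFourier s u) 2) :
    besselPotential E3 ℂ s U = ((𝓕⁻ (hw.toLp _) : L2) : 𝓢'(E3, ℂ)) := by
  have hm : (fun x : E3 => (((1 + ‖x‖ ^ 2) ^ (s / 2) : ℝ) : ℂ)).HasTemperateGrowth := by
    fun_prop
  rw [← Lp.fourierInv_toTemperedDistribution_eq, besselPotential,
    TemperedDistribution.fourierMultiplierCLM_apply]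
  congr 1
  ext φ
  rw [smulLeftCLM_apply_apply, TemperedDistribution.fourier_apply, hU.2,
    Lp.toTemperedDistribution_apply]
  -- The Fourier transform is symmetric for the bilinear pairing, so it passes from the weighted
  -- test function to `u`.
  have h := VectorFourier.integral_fourierIntegral_smul_eq_flip (e := Real.fourierChar)
    (μ := (volume : Measure E3)) (ν := (volume : Measure E3)) (L := innerₗ E3)
    Real.continuous_fourierChar (by exact continuous_inner)
    (SchwartzMap.smulLeftCLM ℂ
      (fun x : E3 => (((1 + ‖x‖ ^ 2) ^ (s / 2) : ℝ) : ℂ)) φ).integrable hU.1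
  rw [flip_innerₗ] at h
  calc _ = _ := h
    _ = _ := by
      apply integral_congr_ae
      filter_upwards [hw.coeFn_toLp] with x hx
      rw [hx, SchwartzMap.smulLeftCLM_apply_apply hm]
      simp only [smul_eq_mul, weightedFourier]
      change _ * 𝓕 u x = _
      ring

theorem norm_fourierInv_L2 (w : L2) : ‖(𝓕⁻ w : L2)‖ = ‖w‖ := by
  rw [← Lp.norm_fourier_eq, fourier_fourierInv_eq]

/-- Plancherel: the inverse Fourier transform in the Bessel potential is an isometry of `L²`. -/
theorem IsRepresentedBy.sobolevNorm_eq {s : ℝ} {U : 𝓢'(E3, ℂ)} {u : E3 → ℂ}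
    (hU : IsRepresentedBy U u) (hw : MemLp (weightedFourier s u) 2) :
    sobolevNorm s U = eLpNorm (weightedFourier s u) 2 := by
  rw [FiniteVolume.sobolevNorm_eq (hU.besselPotential_eq hw), ← ofReal_norm, norm_fourierInv_L2,
    ofReal_norm, Lp.enorm_toLp]

theorem isRepresentedBy_schwartz (φ : 𝓢(E3, ℂ)) : IsRepresentedBy (φ : 𝓢'(E3, ℂ)) φ :=
  ⟨φ.integrable, fun ψ => by simp⟩

theorem isRepresentedBy_indicator {A : Set E3} (hA : MeasurableSet A) (hA' : volume A ≠ ⊤) :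
    IsRepresentedBy (indicatorDistribution A) (A.indicator 1) := by
  refine ⟨(integrable_indicator_iff hA).2 (integrableOn_const (C := (1 : ℂ)) hA'), fun φ => ?_⟩
  change ∫ x in A, φ x = _
  rw [← integral_indicator hA]
  congr 1
  ext x
  by_cases hx : x ∈ A <;> simp [hx]

/-! ### Fourier transforms of indicator functions of boxes -/

/-- The open box `∏ (a l, b l)`. -/
def box (a b : Fin 3 → ℝ) : Set E3 := {y | ∀ l, y l ∈ Set.Ioo (a l) (b l)}

theorem measurableSet_box (a b : Fin 3 → ℝ) : MeasurableSet (box a b) := by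
  have : box a b = ⋂ l, (fun y : E3 => y l) ⁻¹' Set.Ioo (a l) (b l) := by
    ext y; simp [box]
  rw [this]
  exact MeasurableSet.iInter fun l => (by fun_prop : Measurable fun y : E3 => y l) measurableSet_Ioo

theorem isBounded_box (a b : Fin 3 → ℝ) : Bornology.IsBounded (box a b) := by
  have h : IsCompact ((EuclideanSpace.equiv (Fin 3) ℝ).symm '' Set.Icc a b) :=
    isCompact_Icc.image (EuclideanSpace.equiv (Fin 3) ℝ).symm.continuous
  refine h.isBounded.subset fun y hy => ⟨fun l => y l, ?_, rfl⟩
  exact ⟨fun l => (hy l).1.le, fun l => (hy l).2.le⟩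

theorem volume_box_ne_top (a b : Fin 3 → ℝ) : volume (box a b) ≠ ⊤ :=
  (isBounded_box a b).measure_lt_top.ne

theorem integrable_indicator_box (a b : Fin 3 → ℝ) :
    Integrable ((box a b).indicator (1 : E3 → ℂ)) :=
  (integrable_indicator_iff (measurableSet_box a b)).2
    (integrableOn_const (C := (1 : ℂ)) (volume_box_ne_top a b))

/-- The Fourier transform of the indicator function of `(a, b)`. -/
noncomputable def intervalFourier (a b ξ : ℝ) : ℂ :=
  ∫ t in Set.Ioo a b, Complex.exp (-(2 * Real.pi * ξ) * Complex.I * t)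

theorem norm_exp_neg_two_pi_mul (ξ t : ℝ) :
    ‖Complex.exp (-(2 * Real.pi * ξ) * Complex.I * t)‖ = 1 := by
  rw [show (-(2 * Real.pi * ξ) * Complex.I * t : ℂ)
    = ((-(2 * Real.pi * ξ) * t : ℝ) : ℂ) * Complex.I by push_cast; ring,
    Complex.norm_exp_ofReal_mul_I]

/-- The endpoint `max a b` encodes an empty interval when `b ≤ a`. No ordering of the endpoints is
needed later, although the cut-off cells may be empty. -/
theorem intervalFourier_eq (a b ξ : ℝ) :
    intervalFourier a b ξ =
      ∫ t in a..max a b, Complex.exp (-(2 * Real.pi * ξ) * Complex.I * t) := by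
  rw [intervalFourier, intervalIntegral.integral_of_le (le_max_left _ _),
    ← integral_Ioc_eq_integral_Ioo]
  congr 2
  rcases le_total a b with h | h
  · rw [max_eq_right h]
  · rw [max_eq_left h, Set.Ioc_self, Set.Ioc_eq_empty (by simpa using h)]

theorem continuous_intervalFourier (ξ : ℝ) :
    Continuous fun p : ℝ × ℝ => intervalFourier p.1 p.2 ξ := by
  have hc : Continuous fun t : ℝ => Complex.exp (-(2 * Real.pi * ξ) * Complex.I * t) := by
    fun_prop
  have hp := intervalIntegral.continuous_primitive (μ := volume)
    (fun a b => hc.intervalIntegrable a b) 0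
  have h : (fun p : ℝ × ℝ => intervalFourier p.1 p.2 ξ) = fun p : ℝ × ℝ =>
      (∫ t in (0 : ℝ)..max p.1 p.2, Complex.exp (-(2 * Real.pi * ξ) * Complex.I * t))
        - ∫ t in (0 : ℝ)..p.1, Complex.exp (-(2 * Real.pi * ξ) * Complex.I * t) := by
    ext p
    rw [intervalFourier_eq, intervalIntegral.integral_interval_sub_left
      (hc.intervalIntegrable _ _) (hc.intervalIntegrable _ _)]
  rw [h]
  exact (hp.comp (continuous_fst.max continuous_snd)).sub (hp.comp continuous_fst)

theorem norm_intervalFourier_le {a b : ℝ} (ha : 0 ≤ a) (hb : b ≤ 1) (ξ : ℝ) :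
    ‖intervalFourier a b ξ‖ ≤ 1 := by
  have h := norm_setIntegral_le_of_norm_le_const (μ := volume) (s := Set.Ioo a b) (C := 1)
    (f := fun t : ℝ => Complex.exp (-(2 * Real.pi * ξ) * Complex.I * t)) (by simp)
    (fun t _ => (norm_exp_neg_two_pi_mul ξ t).le)
  refine h.trans ?_
  rw [one_mul, Real.volume_real_Ioo]
  exact max_le (by linarith) zero_le_one

theorem norm_intervalFourier_mul_le (a b ξ : ℝ) : ‖intervalFourier a b ξ‖ * |ξ| ≤ 1 := by
  rcases eq_or_ne ξ 0 with rfl | hξ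
  · simp
  have hc : (-(2 * Real.pi * ξ) * Complex.I : ℂ) ≠ 0 := by
    simp [Real.pi_ne_zero, hξ]
  have h3 : ‖(-(2 * Real.pi * ξ) * Complex.I : ℂ)‖ = 2 * Real.pi * |ξ| := by
    simp [abs_of_pos Real.pi_pos]
  rw [intervalFourier_eq, integral_exp_mul_complex hc, norm_div, h3]
  have hx : 0 < |ξ| := abs_pos.2 hξ
  -- The integral is a difference of two unit numbers over `-2πiξ`, so its modulus is at most `2 /
  -- (2π|ξ|)`.
  have h4 := norm_sub_le (Complex.exp (-(2 * Real.pi * ξ) * Complex.I * (max a b : ℝ)))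
    (Complex.exp (-(2 * Real.pi * ξ) * Complex.I * a))
  rw [norm_exp_neg_two_pi_mul, norm_exp_neg_two_pi_mul] at h4
  rw [div_mul_eq_mul_div, div_le_one (by positivity)]
  have := Real.pi_gt_three
  nlinarith

theorem norm_intervalFourier_sq_le {a b : ℝ} (ha : 0 ≤ a) (hb : b ≤ 1) (ξ : ℝ) :
    ‖intervalFourier a b ξ‖ ^ 2 ≤ 2 * (1 + ξ ^ 2)⁻¹ := by
  have h1 := norm_intervalFourier_le ha hb ξ
  have h2 := norm_intervalFourier_mul_le a b ξ
  have h3 : ‖intervalFourier a b ξ‖ ^ 2 ≤ 1 := pow_le_one₀ (norm_nonneg _) h1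
  have h4 : (‖intervalFourier a b ξ‖ * |ξ|) ^ 2 ≤ 1 := pow_le_one₀ (by positivity) h2
  rw [mul_pow, sq_abs] at h4
  rw [← div_eq_mul_inv, le_div_iff₀ (by positivity)]
  linarith

theorem integral_prod_apply (f : Fin 3 → ℝ → ℂ) :
    ∫ y : E3, ∏ l, f l (y l) = ∏ l, ∫ t, f l t := by
  rw [← (PiLp.volume_preserving_toLp (Fin 3)).integral_comp
    (MeasurableEquiv.toLp 2 _).measurableEmbedding]
  exact integral_fintype_prod_volume_eq_prod f

theorem fourier_indicator_box (a b : Fin 3 → ℝ) (ξ : E3) :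
    𝓕 ((box a b).indicator (1 : E3 → ℂ)) ξ = ∏ l, intervalFourier (a l) (b l) (ξ l) := by
  have h : ∀ l, intervalFourier (a l) (b l) (ξ l) =
      ∫ t, (Set.Ioo (a l) (b l)).indicator
        (fun t : ℝ => Complex.exp (-(2 * Real.pi * ξ l) * Complex.I * t)) t := fun l =>
    (integral_indicator measurableSet_Ioo).symm
  simp only [h]
  rw [← integral_prod_apply, Real.fourier_eq]
  congr 1
  ext y
  by_cases hy : y ∈ box a b
  · rw [Finset.prod_congr rfl fun l _ => Set.indicator_of_mem (hy l) _, ← Complex.exp_sum,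
      Set.indicator_of_mem hy, Circle.smul_def, Real.fourierChar_apply, Pi.one_apply, smul_eq_mul,
      mul_one]
    congr 1
    simp only [PiLp.inner_apply, RCLike.inner_apply, conj_trivial, Fin.sum_univ_three]
    push_cast
    ring
  · rw [Set.indicator_of_notMem hy, smul_zero]
    obtain ⟨l, hl⟩ := not_forall.1 hy
    exact (Finset.prod_eq_zero (Finset.mem_univ l) (Set.indicator_of_notMem hl _)).symm

/-! ### Functions whose Fourier transform decays like that of a box -/

/-- The function `∏ 2 / (1 + ξ_l²)`. -/
noncomputable def boxMajorant (ξ : E3) : ℝ := ∏ l, 2 * (1 + ξ l ^ 2)⁻¹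

theorem boxMajorant_nonneg (ξ : E3) : 0 ≤ boxMajorant ξ :=
  Finset.prod_nonneg fun l _ => by positivity

/-- Integrable functions whose Fourier transform decays like that of the indicator function
of a box. -/
def IsBoxLike (u : E3 → ℂ) : Prop :=
  Integrable u ∧ ∀ ξ, ‖𝓕 u ξ‖ ^ 2 ≤ boxMajorant ξ

theorem isBoxLike_indicator_box {a b : Fin 3 → ℝ} (ha : 0 ≤ a) (hb : b ≤ 1) :
    IsBoxLike ((box a b).indicator 1) := by
  refine ⟨integrable_indicator_box a b, fun ξ => ?_⟩
  rw [fourier_indicator_box, norm_prod, ← Finset.prod_pow]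
  exact Finset.prod_le_prod (fun _ _ => by positivity) fun l _ =>
    norm_intervalFourier_sq_le (ha l) (hb l) _

/-- The function `(1 + |ξ|²)^s ∏ 2 / (1 + ξ_l²)`. -/
noncomputable def weightedMajorant (s : ℝ) (ξ : E3) : ℝ := (1 + ‖ξ‖ ^ 2) ^ s * boxMajorant ξ

theorem weightedMajorant_nonneg (s : ℝ) (ξ : E3) : 0 ≤ weightedMajorant s ξ :=
  mul_nonneg (by positivity) (boxMajorant_nonneg ξ)

theorem integrable_weightedMajorant {s : ℝ} (hs : s < 1 / 2) :
    Integrable (weightedMajorant s) := by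
  -- The comparison of `1 + |ξ|²` with `∏ (1 + ξ_l²)` survives only nonnegative powers, so a
  -- negative `s` is first raised to `0`.
  set t := max s 0
  have ht : t < 1 / 2 := max_lt hs (by norm_num)
  have ht0 : 0 ≤ t := le_max_right _ _
  -- The only use of `s < 1/2`: integrability on the line requires `2 (1 - t) > 1`.
  have h1 : Integrable fun r : ℝ => 2 * (1 + r ^ 2) ^ (t - 1) := by
    have h := integrable_rpow_neg_one_add_norm_sq (E := ℝ) (μ := volume) (r := 2 * (1 - t))
      (by simp; linarith)
    refine (h.const_mul 2).congr (ae_of_all _ fun r => ?_)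
    simp only [Real.norm_eq_abs, sq_abs]
    congr 2
    ring
  have h2 : Integrable fun ξ : E3 => ∏ l, 2 * (1 + ξ l ^ 2) ^ (t - 1) := by
    rw [← (PiLp.volume_preserving_toLp (Fin 3)).integrable_comp_emb
      (MeasurableEquiv.toLp 2 _).measurableEmbedding]
    exact Integrable.fintype_prod (μ := fun _ => volume)
      (f := fun _ r => 2 * (1 + r ^ 2) ^ (t - 1)) fun _ => h1
  refine h2.mono' ?_ (ae_of_all _ fun ξ => ?_)
  · apply Measurable.aestronglyMeasurable
    unfold weightedMajorant boxMajorant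
    fun_prop
  · rw [Real.norm_of_nonneg (weightedMajorant_nonneg s ξ), weightedMajorant, boxMajorant]
    have h3 : (1 + ‖ξ‖ ^ 2) ^ s ≤ ∏ l, (1 + ξ l ^ 2) ^ t := by
      calc (1 + ‖ξ‖ ^ 2) ^ s ≤ (1 + ‖ξ‖ ^ 2) ^ t :=
            Real.rpow_le_rpow_of_exponent_le (by simp) (le_max_left _ _)
        _ ≤ (∏ l, (1 + ξ l ^ 2)) ^ t := by
            refine Real.rpow_le_rpow (by positivity) ?_ ht0
            rw [EuclideanSpace.real_norm_sq_eq, Fin.sum_univ_three, Fin.prod_univ_three]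
            have := sq_nonneg (ξ 0); have := sq_nonneg (ξ 1); have := sq_nonneg (ξ 2)
            nlinarith [mul_nonneg (sq_nonneg (ξ 0)) (sq_nonneg (ξ 1)),
              mul_nonneg (sq_nonneg (ξ 0)) (sq_nonneg (ξ 2)),
              mul_nonneg (sq_nonneg (ξ 1)) (sq_nonneg (ξ 2)),
              mul_nonneg (mul_nonneg (sq_nonneg (ξ 0)) (sq_nonneg (ξ 1))) (sq_nonneg (ξ 2))]
        _ = ∏ l, (1 + ξ l ^ 2) ^ t := (Real.finsetProd_rpow _ _ (fun l _ => by positivity) t).symm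
    calc _ ≤ (∏ l, (1 + ξ l ^ 2) ^ t) * ∏ l, 2 * (1 + ξ l ^ 2)⁻¹ :=
          mul_le_mul_of_nonneg_right h3 (boxMajorant_nonneg ξ)
      _ = _ := by
          rw [← Finset.prod_mul_distrib]
          refine Finset.prod_congr rfl fun l _ => ?_
          rw [Real.rpow_sub (by positivity), Real.rpow_one]
          field_simp

theorem norm_weightedFourier_sq (s : ℝ) (u : E3 → ℂ) (ξ : E3) :
    ‖weightedFourier s u ξ‖ ^ 2 = (1 + ‖ξ‖ ^ 2) ^ s * ‖𝓕 u ξ‖ ^ 2 := by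
  rw [weightedFourier, norm_mul, mul_pow, Complex.norm_real,
    Real.norm_of_nonneg (by positivity), ← Real.rpow_mul_natCast (by positivity)]
  congr 2
  push_cast
  ring

theorem aestronglyMeasurable_weightedFourier (s : ℝ) {u : E3 → ℂ} (hu : Integrable u) :
    AEStronglyMeasurable (weightedFourier s u) volume := by
  have h : Continuous (𝓕 u) := VectorFourier.fourierIntegral_continuous
    Real.continuous_fourierChar (by exact continuous_inner) hu
  have hm : (fun x : E3 => (((1 + ‖x‖ ^ 2) ^ (s / 2) : ℝ) : ℂ)).HasTemperateGrowth := by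
    fun_prop
  exact (hm.1.continuous.mul h).aestronglyMeasurable

theorem IsBoxLike.norm_weightedFourier_sq_le {u : E3 → ℂ} (hu : IsBoxLike u) (s : ℝ) (ξ : E3) :
    ‖weightedFourier s u ξ‖ ^ 2 ≤ weightedMajorant s ξ := by
  rw [norm_weightedFourier_sq]
  exact mul_le_mul_of_nonneg_left (hu.2 ξ) (by positivity)

theorem memLp_two_of_norm_sq_le {w : E3 → ℂ} {D : E3 → ℝ} (hw : AEStronglyMeasurable w volume)
    (hD : Integrable D) (h : ∀ ξ, ‖w ξ‖ ^ 2 ≤ D ξ) : MemLp w 2 := by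
  rw [memLp_two_iff_integrable_sq_norm hw]
  exact hD.mono' (hw.norm.pow 2) (ae_of_all _ fun ξ => by simpa using h ξ)

theorem eLpNorm_two_sq (w : E3 → ℂ) :
    eLpNorm w 2 volume ^ 2 = ∫⁻ ξ, ENNReal.ofReal (‖w ξ‖ ^ 2) := by
  have h := eLpNorm_nnreal_pow_eq_lintegral (f := w) (μ := volume) (p := 2) (by norm_num)
  simp only [NNReal.coe_ofNat, ENNReal.coe_ofNat, ENNReal.rpow_ofNat] at h
  rw [h]
  refine lintegral_congr fun ξ => ?_
  rw [← ofReal_norm, ENNReal.ofReal_pow (norm_nonneg _)]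

theorem IsBoxLike.memLp_weightedFourier {s : ℝ} (hs : s < 1 / 2) {u : E3 → ℂ}
    (hu : IsBoxLike u) : MemLp (weightedFourier s u) 2 :=
  memLp_two_of_norm_sq_le (aestronglyMeasurable_weightedFourier s hu.1)
    (integrable_weightedMajorant hs) (hu.norm_weightedFourier_sq_le s)

theorem weightedFourier_sub (s : ℝ) {u v : E3 → ℂ} (hu : Integrable u) (hv : Integrable v) :
    weightedFourier s (u - v) = weightedFourier s u - weightedFourier s v := by
  ext ξ
  simp only [weightedFourier, Pi.sub_apply]
  rw [← mul_sub]
  congr 1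
  simp only [Real.fourier_eq, Pi.sub_apply, smul_sub]
  exact integral_sub ((Real.fourierIntegral_convergent_iff ξ).2 hu)
    ((Real.fourierIntegral_convergent_iff ξ).2 hv)

/-- The bound does not depend on `u`, which makes the final constant independent of the position of
the box. -/
theorem IsBoxLike.sobolevNorm_le {s : ℝ} (hs : s < 1 / 2) {U : 𝓢'(E3, ℂ)} {u : E3 → ℂ}
    (hu : IsBoxLike u) (hU : IsRepresentedBy U u) :
    sobolevNorm s U ^ 2 ≤ ∫⁻ ξ, ENNReal.ofReal (weightedMajorant s ξ) := by
  rw [hU.sobolevNorm_eq (hu.memLp_weightedFourier hs), eLpNorm_two_sq]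
  exact lintegral_mono fun ξ => ENNReal.ofReal_le_ofReal (hu.norm_weightedFourier_sq_le s ξ)

/-- For functions with a common majorant of their Fourier transforms, pointwise convergence of the
Fourier transforms implies convergence in `H^s` for all `s < 1/2`. -/
theorem tendsto_sobolevNorm_sub {ι : Type*} {l : Filter ι} [l.IsCountablyGenerated] {s : ℝ}
    (hs : s < 1 / 2) {U : ι → 𝓢'(E3, ℂ)} {V : 𝓢'(E3, ℂ)} {u : ι → E3 → ℂ} {v : E3 → ℂ}
    (hU : ∀ i, IsRepresentedBy (U i) (u i)) (hV : IsRepresentedBy V v)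
    (hu : ∀ i, IsBoxLike (u i)) (hv : IsBoxLike v)
    (h : ∀ ξ, Tendsto (fun i => 𝓕 (u i) ξ) l (𝓝 (𝓕 v ξ))) :
    Tendsto (fun i => sobolevNorm s (U i - V)) l (𝓝 0) := by
  have hmem : ∀ i, MemLp (weightedFourier s (u i - v)) 2 := fun i => by
    rw [weightedFourier_sub s (hu i).1 hv.1]
    exact ((hu i).memLp_weightedFourier hs).sub (hv.memLp_weightedFourier hs)
  have hbound : ∀ i ξ, ‖weightedFourier s (u i - v) ξ‖ ^ 2 ≤ 4 * weightedMajorant s ξ := by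
    intro i ξ
    rw [weightedFourier_sub s (hu i).1 hv.1, Pi.sub_apply]
    have h1 := (hu i).norm_weightedFourier_sq_le s ξ
    have h2 := hv.norm_weightedFourier_sq_le s ξ
    have h3 := norm_sub_le (weightedFourier s (u i) ξ) (weightedFourier s v ξ)
    have h4 := pow_le_pow_left₀ (norm_nonneg _) h3 2
    nlinarith [sq_nonneg (‖weightedFourier s (u i) ξ‖ - ‖weightedFourier s v ξ‖)]
  have hlim : Tendsto (fun i => ∫⁻ ξ, ENNReal.ofReal (‖weightedFourier s (u i - v) ξ‖ ^ 2)) l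
      (𝓝 (∫⁻ _ : E3, 0)) := by
    -- Dominated convergence needs a countably generated filter; it is applied to sequences and to
    -- neighbourhoods of a point of `ℝ³`.
    refine tendsto_lintegral_filter_of_dominated_convergence'
      (fun ξ => ENNReal.ofReal (4 * weightedMajorant s ξ)) ?_ ?_ ?_ ?_
    · exact Eventually.of_forall fun i =>
        ((hmem i).1.norm.pow 2).aemeasurable.ennreal_ofReal
    · exact Eventually.of_forall fun i => ae_of_all _ fun ξ =>
        ENNReal.ofReal_le_ofReal (hbound i ξ)
    · exact ((integrable_weightedMajorant hs).const_mul 4).lintegral_lt_top.ne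
    · refine ae_of_all _ fun ξ => ?_
      have h5 : Tendsto (fun i => weightedFourier s (u i - v) ξ) l (𝓝 0) := by
        have h6 := ((h ξ).const_mul (((1 + ‖ξ‖ ^ 2) ^ (s / 2) : ℝ) : ℂ)).sub_const
          (weightedFourier s v ξ)
        rw [← weightedFourier, sub_self] at h6
        refine h6.congr fun i => ?_
        rw [weightedFourier_sub s (hu i).1 hv.1]
        rfl
      have h7 := ENNReal.tendsto_ofReal (h5.norm.pow 2)
      simpa using h7
  rw [lintegral_zero] at hlim
  have heq : ∀ i, sobolevNorm s (U i - V)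
      = (∫⁻ ξ, ENNReal.ofReal (‖weightedFourier s (u i - v) ξ‖ ^ 2)) ^ (1 / 2 : ℝ) := fun i => by
    rw [((hU i).sub hV).sobolevNorm_eq (hmem i), ← eLpNorm_two_sq, ← ENNReal.rpow_natCast,
      ← ENNReal.rpow_mul]
    norm_num
  simp only [heq]
  have := (ENNReal.continuous_rpow_const (y := 1 / 2)).tendsto 0 |>.comp hlim
  simpa [Function.comp_def] using this

/-! ### Approximation of indicator functions of boxes by test functions -/

/-- A bump function on `ℝ³` supported in the ball of radius `1 / (2 (n + 1))`. -/
noncomputable def mollifier (n : ℕ) : ContDiffBump (0 : E3) where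
  rIn := 1 / (n + 1) / 4
  rOut := 1 / (n + 1) / 2
  rIn_pos := by positivity
  rIn_lt_rOut := by
    have : (0 : ℝ) < 1 / (n + 1) := by positivity
    linarith

theorem mollifier_rOut (n : ℕ) : (mollifier n).rOut = 1 / (n + 1) / 2 := rfl

/-- The box shrunk by `1 / (n + 1)` on all sides. -/
noncomputable def shrunkBox (a b : Fin 3 → ℝ) (n : ℕ) : Set E3 :=
  box (fun l => a l + 1 / (n + 1)) (fun l => b l - 1 / (n + 1))

/-- The mollified indicator function of the shrunk box. -/
noncomputable def mollifiedIndicator (a b : Fin 3 → ℝ) (n : ℕ) : E3 → ℝ :=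
  convolution ((mollifier n).normed volume) ((shrunkBox a b n).indicator 1)
    (ContinuousLinearMap.lsmul ℝ ℝ) volume

theorem integrable_indicator_shrunkBox (a b : Fin 3 → ℝ) (n : ℕ) :
    Integrable ((shrunkBox a b n).indicator (1 : E3 → ℝ)) :=
  (integrable_indicator_iff (measurableSet_box _ _)).2
    (integrableOn_const (C := (1 : ℝ)) (volume_box_ne_top _ _))

theorem contDiff_mollifiedIndicator (a b : Fin 3 → ℝ) (n : ℕ) :
    ContDiff ℝ ∞ (mollifiedIndicator a b n) :=
  (mollifier n).hasCompactSupport_normed.contDiff_convolution_left (n := ⊤) _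
    (mollifier n).contDiff_normed (integrable_indicator_shrunkBox a b n).locallyIntegrable

/-- The mollifier's radius is half of the shrinkage, so a margin of the other half remains. It keeps
the support compactly inside the open cube even if the box touches its boundary. -/
theorem support_mollifiedIndicator_subset (a b : Fin 3 → ℝ) (n : ℕ) :
    Function.support (mollifiedIndicator a b n) ⊆
      (EuclideanSpace.equiv (Fin 3) ℝ).symm ''
        Set.Icc (fun l => a l + 1 / (n + 1) / 2) (fun l => b l - 1 / (n + 1) / 2) := by
  intro y hy
  obtain ⟨v, hv, w, hw, rfl⟩ := support_convolution_subset _ hy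
  rw [ContDiffBump.support_normed_eq, mem_ball_zero_iff, mollifier_rOut] at hv
  have hw' : w ∈ shrunkBox a b n := Set.mem_of_indicator_ne_zero hw
  have hvl : ∀ l, |v l| < 1 / (n + 1) / 2 := fun l => (PiLp.norm_apply_le v l).trans_lt hv
  refine ⟨fun l => (v + w) l, ⟨fun l => ?_, fun l => ?_⟩, rfl⟩
  · have h1 := (abs_lt.1 (hvl l)).1
    have h2 := (hw' l).1
    simp only [PiLp.add_apply]
    linarith
  · have h1 := (abs_lt.1 (hvl l)).2
    have h2 := (hw' l).2
    simp only [PiLp.add_apply]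
    linarith

theorem tsupport_mollifiedIndicator_subset (a b : Fin 3 → ℝ) (n : ℕ) :
    tsupport (mollifiedIndicator a b n) ⊆
      (EuclideanSpace.equiv (Fin 3) ℝ).symm ''
        Set.Icc (fun l => a l + 1 / (n + 1) / 2) (fun l => b l - 1 / (n + 1) / 2) :=
  closure_minimal (support_mollifiedIndicator_subset a b n)
    (isCompact_Icc.image (EuclideanSpace.equiv (Fin 3) ℝ).symm.continuous).isClosed

/-- The mollified indicator function as a test function on the cube. -/
noncomputable def approxIndicator {a b : Fin 3 → ℝ} (ha : 0 ≤ a) (hb : b ≤ 1) (n : ℕ) :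
    𝓓(unitCube, ℝ) where
  toFun := mollifiedIndicator a b n
  contDiff' := contDiff_mollifiedIndicator a b n
  hasCompactSupport' :=
    (isCompact_Icc.image (EuclideanSpace.equiv (Fin 3) ℝ).symm.continuous).of_isClosed_subset
      (isClosed_tsupport _) (tsupport_mollifiedIndicator_subset a b n)
  tsupport_subset' := by
    refine (tsupport_mollifiedIndicator_subset a b n).trans ?_
    rintro _ ⟨y, hy, rfl⟩ l
    have h0 : (0 : ℝ) < 1 / (n + 1) / 2 := by positivity
    have h1 := hy.1 l
    have h2 := hy.2 l
    have h3 := ha l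
    have h4 := hb l
    simp only [Pi.zero_apply, Pi.one_apply] at h3 h4
    exact ⟨by change 0 < y l; linarith, by change y l < 1; linarith⟩

theorem approxIndicator_apply {a b : Fin 3 → ℝ} (ha : 0 ≤ a) (hb : b ≤ 1) (n : ℕ) :
    (fun x => ((approxIndicator ha hb n x : ℝ) : ℂ)) =
      convolution (fun x => (((mollifier n).normed volume x : ℝ) : ℂ))
        ((shrunkBox a b n).indicator 1) (ContinuousLinearMap.mul ℂ ℂ) volume := by
  ext x
  change ((mollifiedIndicator a b n x : ℝ) : ℂ) = _
  rw [mollifiedIndicator, convolution_def, convolution_def, ← integral_complex_ofReal]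
  congr 1
  ext t
  by_cases h : x - t ∈ shrunkBox a b n <;> simp [h]

theorem integrable_mollifier (n : ℕ) :
    Integrable fun x => (((mollifier n).normed volume x : ℝ) : ℂ) :=
  (mollifier n).integrable_normed.ofReal

theorem fourier_approxIndicator {a b : Fin 3 → ℝ} (ha : 0 ≤ a) (hb : b ≤ 1) (n : ℕ) (ξ : E3) :
    𝓕 (fun x => ((approxIndicator ha hb n x : ℝ) : ℂ)) ξ =
      𝓕 (fun x => (((mollifier n).normed volume x : ℝ) : ℂ)) ξ *
        ∏ l, intervalFourier (a l + 1 / (n + 1)) (b l - 1 / (n + 1)) (ξ l) := by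
  rw [approxIndicator_apply, Real.fourier_mul_convolution_eq (integrable_mollifier n)
    (by exact integrable_indicator_box _ _), ← fourier_indicator_box]
  rfl

theorem norm_fourier_mollifier_le (n : ℕ) (ξ : E3) :
    ‖𝓕 (fun x => (((mollifier n).normed volume x : ℝ) : ℂ)) ξ‖ ≤ 1 := by
  refine (VectorFourier.norm_fourierIntegral_le_integral_norm Real.fourierChar volume
    (innerₗ E3) _ ξ).trans ?_
  simp only [Complex.norm_real, Real.norm_of_nonneg ((mollifier n).nonneg_normed _)]
  exact (mollifier n).integral_normed.le

theorem tendsto_fourier_mollifier (ξ : E3) :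
    Tendsto (fun n => 𝓕 (fun x => (((mollifier n).normed volume x : ℝ) : ℂ)) ξ) atTop (𝓝 1) := by
  have hr : Tendsto (fun n => (mollifier n).rOut) atTop (𝓝 0) := by
    simp only [mollifier_rOut]
    simpa using (tendsto_one_div_add_atTop_nhds_zero_nat (𝕜 := ℝ)).div_const 2
  have hc : Continuous fun x : E3 =>
      Complex.exp ((2 * Real.pi * inner ℝ x ξ : ℝ) * Complex.I) := by fun_prop
  -- The Fourier transform at `ξ` is the mollification at the origin of a character, whose value
  -- there is `1`.
  have h := ContDiffBump.convolution_tendsto_right_of_continuous (μ := volume) hr hc 0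
  simp only [inner_zero_left, mul_zero, Complex.ofReal_zero, zero_mul, Complex.exp_zero] at h
  refine h.congr fun n => ?_
  rw [convolution_def, Real.fourier_eq]
  congr 1
  ext t
  simp [Circle.smul_def, Real.fourierChar_apply, mul_comm]

/-- Mollification multiplies the transform of a smaller box by a factor of modulus at most `1`, so
the same majorant serves for all `n`. -/
theorem isBoxLike_approxIndicator {a b : Fin 3 → ℝ} (ha : 0 ≤ a) (hb : b ≤ 1) (n : ℕ) :
    IsBoxLike fun x => ((approxIndicator ha hb n x : ℝ) : ℂ) := by
  refine ⟨(testToSchwartz (approxIndicator ha hb n)).integrable, fun ξ => ?_⟩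
  have h0 : (0 : ℝ) < 1 / (n + 1) := by positivity
  have h := (isBoxLike_indicator_box (a := fun l => a l + 1 / (n + 1))
    (b := fun l => b l - 1 / (n + 1)) (fun l => by have := ha l; simp at this ⊢; positivity)
    (fun l => by have := hb l; simp only [Pi.one_apply] at this ⊢; linarith)).2 ξ
  rw [fourier_indicator_box] at h
  rw [fourier_approxIndicator, norm_mul, mul_pow]
  exact (mul_le_of_le_one_left (by positivity)
    (pow_le_one₀ (norm_nonneg _) (norm_fourier_mollifier_le n ξ))).trans h

theorem tendsto_fourier_approxIndicator {a b : Fin 3 → ℝ} (ha : 0 ≤ a) (hb : b ≤ 1) (ξ : E3) :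
    Tendsto (fun n => 𝓕 (fun x => ((approxIndicator ha hb n x : ℝ) : ℂ)) ξ) atTop
      (𝓝 (𝓕 ((box a b).indicator (1 : E3 → ℂ)) ξ)) := by
  simp only [fourier_approxIndicator, fourier_indicator_box]
  rw [← one_mul (∏ l, intervalFourier (a l) (b l) (ξ l))]
  refine (tendsto_fourier_mollifier ξ).mul (tendsto_finsetProd _ fun l _ => ?_)
  have h0 := tendsto_one_div_add_atTop_nhds_zero_nat (𝕜 := ℝ)
  have h1 : Tendsto (fun n : ℕ => (a l + 1 / ((n : ℝ) + 1), b l - 1 / ((n : ℝ) + 1))) atTop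
      (𝓝 (a l, b l)) := by
    have := (h0.const_add (a l)).prodMk_nhds (h0.const_sub (b l))
    simpa using this
  exact ((continuous_intervalFourier (ξ l)).tendsto (a l, b l)).comp h1

theorem isRepresentedBy_indicator_box (a b : Fin 3 → ℝ) :
    IsRepresentedBy (indicatorDistribution (box a b)) ((box a b).indicator 1) :=
  isRepresentedBy_indicator (measurableSet_box a b) (volume_box_ne_top a b)

theorem tendsto_approxIndicator {a b : Fin 3 → ℝ} (ha : 0 ≤ a) (hb : b ≤ 1) :
    Tendsto (approxIndicator ha hb) atTop (toIndicator (box a b)) := by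
  simp only [toIndicator, tendsto_iInf, tendsto_comap_iff]
  intro τ hτ
  exact tendsto_sobolevNorm_sub hτ
    (fun n => isRepresentedBy_schwartz (testToSchwartz (approxIndicator ha hb n)))
    (isRepresentedBy_indicator_box a b) (isBoxLike_approxIndicator ha hb)
    (isBoxLike_indicator_box ha hb) (tendsto_fourier_approxIndicator ha hb)

/-- Nontriviality of the filter makes the pairing unique and `limUnder` meaningful. -/
theorem toIndicator_box_neBot {a b : Fin 3 → ℝ} (ha : 0 ≤ a) (hb : b ≤ 1) :
    (toIndicator (box a b)).NeBot :=
  (tendsto_approxIndicator ha hb).neBot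

/-! ### The pairing of Sobolev distributions with indicator functions of boxes -/

theorem exists_potential_box {a b : Fin 3 → ℝ} (ha : 0 ≤ a) (hb : b ≤ 1) {s : ℝ}
    (hs : s < 1 / 2) :
    ∃ w : L2, besselPotential E3 ℂ s (indicatorDistribution (box a b)) = (w : 𝓢'(E3, ℂ)) :=
  ⟨_, (isRepresentedBy_indicator_box a b).besselPotential_eq
    ((isBoxLike_indicator_box ha hb).memLp_weightedFourier hs)⟩

theorem besselPotential_sub_eq {s : ℝ} {U V : 𝓢'(E3, ℂ)} {g h : L2}
    (hU : besselPotential E3 ℂ s U = (g : 𝓢'(E3, ℂ)))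
    (hV : besselPotential E3 ℂ s V = (h : 𝓢'(E3, ℂ))) :
    besselPotential E3 ℂ s (U - V) = ((g - h : L2) : 𝓢'(E3, ℂ)) := by
  rw [map_sub, hU, hV]
  exact (map_sub (Lp.toTemperedDistributionCLM ℂ volume 2) g h).symm

theorem tendsto_sobolevNorm_toIndicator (A : Set E3) {τ : ℝ} (hτ : τ < 1 / 2) :
    Tendsto (fun φ => sobolevNorm τ ((testToSchwartz φ : 𝓢'(E3, ℂ)) - indicatorDistribution A))
      (toIndicator A) (𝓝 0) :=
  tendsto_comap.mono_left (iInf₂_le τ hτ)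

/-- An element of `H^σ` is continuous on test functions converging to an indicator function. -/
theorem hasPairing_re_l2Pairing {σ : ℝ} (hσ : -1 / 2 < σ) {f : 𝓓'(unitCube, ℝ)} {F : 𝓢'(E3, ℂ)}
    (hF : IsRestriction F f) {g : L2} (hg : besselPotential E3 ℂ σ F = (g : 𝓢'(E3, ℂ)))
    {A : Set E3} {w : L2}
    (hw : besselPotential E3 ℂ (-σ) (indicatorDistribution A) = (w : 𝓢'(E3, ℂ))) :
    HasPairing f A (l2Pairing g w).re := by
  have h1 : Tendsto (fun φ => F (testToSchwartz φ)) (toIndicator A) (𝓝 (l2Pairing g w)) := by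
    rw [tendsto_iff_edist_tendsto_0]
    -- The error of the pairing is at most this constant times the `H^{-σ}` distance to the
    -- indicator, and `-σ < 1/2` is an order at which `toIndicator` forces convergence.
    have h2 := ENNReal.Tendsto.const_mul (a := ‖l2Pairing g‖ₑ)
      (tendsto_sobolevNorm_toIndicator A (τ := -σ) (by linarith)) (Or.inr enorm_ne_top)
    rw [mul_zero] at h2
    refine tendsto_of_tendsto_of_tendsto_of_le_of_le tendsto_const_nhds h2
      (fun _ => zero_le) fun φ => ?_
    obtain ⟨h, hh⟩ := (testToSchwartz φ).memSobolev (s := -σ) (p := 2)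
    rw [edist_eq_enorm_sub, apply_eq_l2Pairing hg hh, ← map_sub,
      sobolevNorm_eq (besselPotential_sub_eq hh hw)]
    exact (l2Pairing g).le_opENorm _
  refine ((Complex.continuous_re.tendsto _).comp h1).congr fun φ => ?_
  simp [hF φ]

theorem indicatorConv_eq {K : Set E3} {f : 𝓓'(unitCube, ℝ)} {x : E3} {a b : Fin 3 → ℝ}
    (ha : 0 ≤ a) (hb : b ≤ 1) (hK : convSet K x = box a b) {c : ℝ}
    (h : HasPairing f (box a b) c) : indicatorConv K f x = c := by
  have := toIndicator_box_neBot ha hb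
  rw [indicatorConv, hK]
  exact h.limUnder_eq

theorem HasPairing.unique {f : 𝓓'(unitCube, ℝ)} {a b : Fin 3 → ℝ} (ha : 0 ≤ a) (hb : b ≤ 1)
    {c d : ℝ} (hc : HasPairing f (box a b) c) (hd : HasPairing f (box a b) d) : c = d :=
  have := toIndicator_box_neBot ha hb
  tendsto_nhds_unique hc hd

theorem existsUnique_hasPairing_box {σ : ℝ} (hσ : -1 / 2 < σ) {f : 𝓓'(unitCube, ℝ)}
    (hf : MemSobolevCube σ f) {a b : Fin 3 → ℝ} (ha : 0 ≤ a) (hb : b ≤ 1) :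
    ∃! c, HasPairing f (box a b) c := by
  obtain ⟨F, ⟨g, hg⟩, hF⟩ := hf
  obtain ⟨w, hw⟩ := exists_potential_box ha hb (s := -σ) (by linarith)
  have h := hasPairing_re_l2Pairing hσ hF hg hw
  exact ⟨_, h, fun d hd => hd.unique ha hb h⟩

theorem continuous_indicatorConv {σ : ℝ} (hσ : -1 / 2 < σ) {f : 𝓓'(unitCube, ℝ)}
    (hf : MemSobolevCube σ f) {K : Set E3} {a b : E3 → Fin 3 → ℝ} (ha : ∀ x, 0 ≤ a x)
    (hb : ∀ x, b x ≤ 1) (hac : Continuous a) (hbc : Continuous b)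
    (hK : ∀ x, convSet K x = box (a x) (b x)) : Continuous (indicatorConv K f) := by
  obtain ⟨F, ⟨g, hg⟩, hF⟩ := hf
  have hσ' : -σ < 1 / 2 := by linarith
  choose w hw using fun x => exists_potential_box (ha x) (hb x) hσ'
  -- The potential of the indicator depends continuously on `x` in `L²`; pairing it with the fixed
  -- `g` is then continuous too.
  have hwc : Continuous w := by
    rw [continuous_iff_continuousAt]
    intro x
    rw [ContinuousAt, tendsto_iff_edist_tendsto_0]
    have h := tendsto_sobolevNorm_sub (l := 𝓝 x) hσ'
      (fun y => isRepresentedBy_indicator_box (a y) (b y))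
      (isRepresentedBy_indicator_box (a x) (b x))
      (fun y => isBoxLike_indicator_box (ha y) (hb y))
      (isBoxLike_indicator_box (ha x) (hb x)) fun ξ => by
        simp only [fourier_indicator_box]
        refine tendsto_finsetProd _ fun l _ => ?_
        have hab : Continuous fun y => (a y l, b y l) := by fun_prop
        exact ((continuous_intervalFourier (ξ l)).comp hab).tendsto x
    refine h.congr fun y => ?_
    rw [edist_eq_enorm_sub, sobolevNorm_eq (besselPotential_sub_eq (hw y) (hw x))]
  have h : indicatorConv K f = fun x => (l2Pairing g (w x)).re := funext fun x =>
    indicatorConv_eq (ha x) (hb x) (hK x) (hasPairing_re_l2Pairing hσ hF hg (hw x))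
  rw [h]
  fun_prop

/-- The constant in the continuity estimate of the convolution. -/
noncomputable def convConst (σ : ℝ) : ℝ≥0 :=
  ‖l2Pairing‖₊ * ((∫⁻ ξ, ENNReal.ofReal (weightedMajorant (-σ) ξ)) ^ (1 / 2 : ℝ)).toNNReal + 1

/-- The estimate holds for each extension `F` separately, trivially when its norm is infinite; the
infimum over extensions then gives the quotient norm. -/
theorem enorm_indicatorConv_le {σ : ℝ} (hσ : -1 / 2 < σ) (f : 𝓓'(unitCube, ℝ))
    {K : Set E3} {x : E3} {a b : Fin 3 → ℝ} (ha : 0 ≤ a) (hb : b ≤ 1)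
    (hK : convSet K x = box a b) :
    ‖indicatorConv K f x‖ₑ ≤ convConst σ * sobolevNormCube σ f := by
  have hσ' : -σ < 1 / 2 := by linarith
  -- The summand `1` in `convConst` serves this: the constant can be divided by, and its product
  -- with `⊤` is `⊤`.
  have hC0 : (convConst σ : ℝ≥0∞) ≠ 0 := by simp [convConst]
  rw [mul_comm, ← ENNReal.div_le_iff_le_mul (Or.inl hC0) (Or.inl ENNReal.coe_ne_top)]
  refine le_iInf₂ fun F hF => ?_
  rw [ENNReal.div_le_iff_le_mul (Or.inl hC0) (Or.inl ENNReal.coe_ne_top), mul_comm]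
  by_cases hS : MemSobolev σ 2 F
  · obtain ⟨g, hg⟩ := hS
    obtain ⟨w, hw⟩ := exists_potential_box ha hb hσ'
    rw [indicatorConv_eq ha hb hK (hasPairing_re_l2Pairing hσ hF hg hw), sobolevNorm_eq hg]
    have hI : (∫⁻ ξ, ENNReal.ofReal (weightedMajorant (-σ) ξ)) ^ (1 / 2 : ℝ) ≠ ⊤ :=
      ENNReal.rpow_ne_top_of_nonneg (by norm_num)
        (integrable_weightedMajorant hσ').lintegral_lt_top.ne
    have h1 : ‖w‖ₑ ≤ (∫⁻ ξ, ENNReal.ofReal (weightedMajorant (-σ) ξ)) ^ (1 / 2 : ℝ) := by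
      have h2 := (isBoxLike_indicator_box ha hb).sobolevNorm_le hσ'
        (isRepresentedBy_indicator_box a b)
      rw [sobolevNorm_eq hw] at h2
      have h3 := ENNReal.rpow_le_rpow h2 (z := 1 / 2) (by norm_num)
      rw [← ENNReal.rpow_natCast, ← ENNReal.rpow_mul] at h3
      norm_num at h3 ⊢
      exact h3
    calc ‖(l2Pairing g w).re‖ₑ ≤ ‖l2Pairing g w‖ₑ := by
          rw [← ofReal_norm, ← ofReal_norm]
          exact ENNReal.ofReal_le_ofReal (Complex.abs_re_le_norm _)
      _ ≤ ‖l2Pairing‖ₑ * ‖g‖ₑ * ‖w‖ₑ :=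
          ((l2Pairing g).le_opENorm w).trans (mul_le_mul_left (l2Pairing.le_opENorm g) _)
      _ ≤ ‖l2Pairing‖ₑ * ‖g‖ₑ * (∫⁻ ξ, ENNReal.ofReal (weightedMajorant (-σ) ξ)) ^ (1 / 2 : ℝ) := by
          gcongr
      _ = (‖l2Pairing‖ₑ * (∫⁻ ξ, ENNReal.ofReal (weightedMajorant (-σ) ξ)) ^ (1 / 2 : ℝ))
            * ‖g‖ₑ := by ring
      _ ≤ convConst σ * ‖g‖ₑ := by
          gcongr
          rw [convConst, ENNReal.coe_add, ENNReal.coe_mul, ENNReal.coe_toNNReal hI,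
            enorm_eq_nnnorm]
          exact le_self_add
  · rw [sobolevNorm_eq_top hS, ENNReal.mul_top hC0]
    exact le_top

/-! ### One-dimensional meshes -/

theorem sum_Ioc_zero_eq_sum_range (M : ℕ) (g : ℕ → ℝ) :
    ∑ i ∈ Finset.Ioc 0 M, g i = ∑ i ∈ Finset.range M, g (i + 1) := by
  rw [Finset.range_eq_Ico, Finset.sum_Ico_add' _ 0 M 1]
  exact Finset.sum_congr (by ext i; simp; omega) fun _ _ => rfl

theorem sum_Ioo_zero_eq_sum_range (M : ℕ) {g : ℕ → ℝ} (hg : g 0 = 0) :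
    ∑ i ∈ Finset.Ioo 0 M, g i = ∑ i ∈ Finset.range M, g i := by
  refine Finset.sum_subset (fun i hi => ?_) fun i hi hi' => ?_
  · simp only [Finset.mem_Ioo, Finset.mem_range] at hi ⊢
    exact hi.2
  · simp only [Finset.mem_Ioo, Finset.mem_range, not_and, not_lt] at hi hi'
    rcases Nat.eq_zero_or_pos i with rfl | h
    · exact hg
    · exact absurd (hi' h) (by omega)

theorem sum_Ioo_zero_eq_sum_range_succ (M : ℕ) {g : ℕ → ℝ} (hg : g M = 0) :
    ∑ i ∈ Finset.Ioo 0 M, g i = ∑ i ∈ Finset.range M, g (i + 1) := by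
  rw [← sum_Ioc_zero_eq_sum_range]
  refine Finset.sum_subset (fun i hi => ?_) fun i hi hi' => ?_
  · simp only [Finset.mem_Ioo, Finset.mem_Ioc] at hi ⊢
    omega
  · simp only [Finset.mem_Ioo, Finset.mem_Ioc] at hi hi'
    rw [show i = M by omega, hg]

namespace Mesh1

variable (p : Mesh1)

theorem h_succ (i : ℕ) : p.h (i + 1) = p.pt (i + 1) - p.pt i := rfl

theorem h_succ_pos {i : ℕ} (hi : i < p.M) : 0 < p.h (i + 1) := sub_pos.2 (p.pt_lt i hi)

theorem h_pos {i : ℕ} (h0 : 0 < i) (hi : i ≤ p.M) : 0 < p.h i := by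
  obtain ⟨k, rfl⟩ := Nat.exists_eq_succ_of_ne_zero h0.ne'
  exact p.h_succ_pos hi

theorem hbar_pos {i : ℕ} (h0 : 0 < i) (hi : i < p.M) : 0 < p.hbar i :=
  half_pos (add_pos (p.h_pos h0 hi.le) (p.h_succ_pos hi))

theorem pt_mono {i j : ℕ} (hij : i ≤ j) (hj : j ≤ p.M) : p.pt i ≤ p.pt j := by
  induction j, hij using Nat.le_induction with
  | base => exact le_rfl
  | succ k _ ih => exact (ih (by omega)).trans (p.pt_lt k hj).le

/-- Summation by parts. -/
theorem sum_sub_mul (V : ℕ → ℝ) {v : ℕ → ℝ} (h0 : v 0 = 0) (hM : v p.M = 0) :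
    ∑ i ∈ Finset.Ioo 0 p.M, (V (i + 1) - V i) * v i
      = -∑ i ∈ Finset.Ioc 0 p.M, V i * (v i - v (i - 1)) := by
  rw [sum_Ioo_zero_eq_sum_range _ (by simp [h0]), sum_Ioc_zero_eq_sum_range,
    ← add_eq_zero_iff_eq_neg, ← Finset.sum_add_distrib]
  have h := Finset.sum_range_sub (fun i => V i * v i) p.M
  rw [hM, h0, mul_zero, mul_zero, sub_zero] at h
  rw [← h]
  refine Finset.sum_congr rfl fun i _ => ?_
  rw [Nat.add_sub_cancel]
  ring

/-- Shifting the index turns each sum on the left into part of one on the right, in which the terms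
left over are nonnegative. -/
theorem sum_shift_le {e : ℕ → ℝ} (he : ∀ i, 0 ≤ e i) (h0 : e 0 = 0) (hM : e p.M = 0) :
    ∑ i ∈ Finset.Ioo 0 p.M, (p.h i * e (i - 1) + p.h (i + 1) * e (i + 1))
      ≤ ∑ i ∈ Finset.Ioo 0 p.M, (p.h i + p.h (i + 1)) * e i := by
  simp only [add_mul, Finset.sum_add_distrib]
  rw [add_comm (∑ i ∈ Finset.Ioo 0 p.M, p.h i * e i)]
  refine add_le_add ?_ ?_
  · rw [sum_Ioo_zero_eq_sum_range (g := fun i => p.h (i + 1) * e i) _ (by simp [h0]),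
      show ∑ i ∈ Finset.range p.M, p.h (i + 1) * e i = _ from
        (sum_Ioc_zero_eq_sum_range p.M fun i => p.h i * e (i - 1)).symm]
    refine Finset.sum_le_sum_of_subset_of_nonneg Finset.Ioo_subset_Ioc_self fun i hi _ => ?_
    rw [Finset.mem_Ioc] at hi
    exact mul_nonneg (p.h_pos hi.1 hi.2).le (he _)
  · rw [sum_Ioo_zero_eq_sum_range_succ (g := fun i => p.h i * e i) _ (by simp [hM])]
    refine Finset.sum_le_sum_of_subset_of_nonneg (fun i hi => ?_) fun i hi _ => ?_
    · simp only [Finset.mem_Ioo, Finset.mem_range] at hi ⊢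
      exact hi.2
    · rw [Finset.mem_range] at hi
      exact mul_nonneg (p.h_succ_pos hi).le (he _)

/-- Cauchy-Schwarz for the telescoping sum of increments, with the steps as weights. -/
theorem sq_sub_le {a b : ℕ} (hab : a ≤ b) (hb : b ≤ p.M) (v : ℕ → ℝ) :
    (v b - v a) ^ 2 ≤ (p.pt b - p.pt a) *
      ∑ i ∈ Finset.Ico a b, (v (i + 1) - v i) ^ 2 / p.h (i + 1) := by
  have hpos : ∀ i ∈ Finset.Ico a b, 0 < p.h (i + 1) := fun i hi =>
    p.h_succ_pos ((Finset.mem_Ico.1 hi).2.trans_le hb)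
  have h := Finset.sum_sq_le_sum_mul_sum_of_sq_le_mul (Finset.Ico a b)
    (r := fun i => v (i + 1) - v i) (f := fun i => p.h (i + 1))
    (g := fun i => (v (i + 1) - v i) ^ 2 / p.h (i + 1)) (fun i hi => (hpos i hi).le)
    (fun i hi => div_nonneg (sq_nonneg _) (hpos i hi).le)
    (fun i hi => (mul_div_cancel₀ _ (hpos i hi).ne').ge)
  rw [Finset.sum_Ico_sub v hab] at h
  have h' : ∑ i ∈ Finset.Ico a b, p.h (i + 1) = p.pt b - p.pt a := Finset.sum_Ico_sub p.pt hab
  rwa [h'] at h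

/-- The discrete Dirichlet integral. -/
noncomputable def energy (v : ℕ → ℝ) : ℝ := ∑ i ∈ Finset.Ioc 0 p.M, p.h i * ((v i - v (i - 1)) / p.h i) ^ 2

theorem energy_eq (v : ℕ → ℝ) :
    p.energy v = ∑ i ∈ Finset.range p.M, (v (i + 1) - v i) ^ 2 / p.h (i + 1) := by
  rw [energy, sum_Ioc_zero_eq_sum_range]
  refine Finset.sum_congr rfl fun i hi => ?_
  have := (p.h_succ_pos (Finset.mem_range.1 hi)).ne'
  rw [Nat.add_sub_cancel]
  field_simp

theorem energy_nonneg (v : ℕ → ℝ) : 0 ≤ p.energy v :=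
  Finset.sum_nonneg fun _ hi =>
    mul_nonneg (p.h_pos (Finset.mem_Ioc.1 hi).1 (Finset.mem_Ioc.1 hi).2).le (sq_nonneg _)

theorem sq_le_energy {v : ℕ → ℝ} (h0 : v 0 = 0) (hM : v p.M = 0) {i : ℕ} (hi : i ≤ p.M) :
    v i ^ 2 ≤ p.pt i * (1 - p.pt i) * p.energy v := by
  have h1 := p.sq_sub_le (Nat.zero_le i) hi v
  have h2 := p.sq_sub_le hi le_rfl v
  rw [h0, p.pt_zero, sub_zero, sub_zero] at h1
  rw [hM, p.pt_last, zero_sub, neg_sq] at h2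
  rw [energy_eq, Finset.range_eq_Ico, ← Finset.sum_Ico_consecutive _ (Nat.zero_le i) hi]
  have h3 : 0 ≤ p.pt i := by simpa [p.pt_zero] using p.pt_mono (Nat.zero_le i) hi
  have h4 : p.pt i ≤ 1 := by simpa [p.pt_last] using p.pt_mono hi le_rfl
  -- The estimates from the left and right endpoints are combined with weights `1 - x_i` and `x_i`,
  -- which produces the factor `x_i (1 - x_i)`.
  nlinarith [mul_le_mul_of_nonneg_left h1 (sub_nonneg.2 h4), mul_le_mul_of_nonneg_left h2 h3]

/-- The trapezoidal rule underestimates the integral of the concave function `x (1 - x)`. -/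
theorem sum_hbar_mul_le : ∑ i ∈ Finset.Ioo 0 p.M, p.hbar i * (p.pt i * (1 - p.pt i)) ≤ 1 / 6 := by
  have h1 : ∑ i ∈ Finset.Ioo 0 p.M, p.hbar i * (p.pt i * (1 - p.pt i))
      = (∑ i ∈ Finset.range p.M, p.h (i + 1) * (p.pt (i + 1) * (1 - p.pt (i + 1)))
        + ∑ i ∈ Finset.range p.M, p.h (i + 1) * (p.pt i * (1 - p.pt i))) / 2 := by
    rw [← sum_Ioo_zero_eq_sum_range_succ (g := fun i => p.h i * (p.pt i * (1 - p.pt i))) _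
        (by simp [p.pt_last]),
      ← sum_Ioo_zero_eq_sum_range (g := fun i => p.h (i + 1) * (p.pt i * (1 - p.pt i))) _
        (by simp [p.pt_zero]), ← Finset.sum_add_distrib, Finset.sum_div]
    refine Finset.sum_congr rfl fun i _ => ?_
    rw [hbar]
    ring
  rw [h1, ← Finset.sum_add_distrib, Finset.sum_div]
  have h2 : ∑ i ∈ Finset.range p.M, ((p.pt (i + 1) ^ 2 / 2 - p.pt (i + 1) ^ 3 / 3)
      - (p.pt i ^ 2 / 2 - p.pt i ^ 3 / 3)) = 1 / 6 := by
    rw [Finset.sum_range_sub (fun i => p.pt i ^ 2 / 2 - p.pt i ^ 3 / 3), p.pt_last, p.pt_zero]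
    norm_num
  rw [← h2]
  refine Finset.sum_le_sum fun i hi => ?_
  -- On one interval the integral exceeds the trapezoidal value by exactly `h³ / 6`.
  have hp := pow_pos (p.h_succ_pos (Finset.mem_range.1 hi)) 3
  rw [h_succ] at hp ⊢
  nlinarith

/-- The discrete Friedrichs inequality. -/
theorem sum_hbar_mul_sq_le {v : ℕ → ℝ} (h0 : v 0 = 0) (hM : v p.M = 0) :
    ∑ i ∈ Finset.Ioo 0 p.M, p.hbar i * v i ^ 2 ≤ 1 / 6 * p.energy v := by
  calc _ ≤ ∑ i ∈ Finset.Ioo 0 p.M, p.hbar i * (p.pt i * (1 - p.pt i)) * p.energy v := by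
        refine Finset.sum_le_sum fun i hi => ?_
        rw [Finset.mem_Ioo] at hi
        rw [mul_assoc]
        exact mul_le_mul_of_nonneg_left (p.sq_le_energy h0 hM hi.2.le) (p.hbar_pos hi.1 hi.2).le
    _ ≤ _ := by
        rw [← Finset.sum_mul]
        exact mul_le_mul_of_nonneg_right p.sum_hbar_mul_le (p.energy_nonneg v)

end Mesh1

/-! ### The averaging operator in two variables -/

/-- The averaging operator in two variables. -/
noncomputable def mu2 (q r : Mesh1) (d : ℕ → ℕ → ℝ) (j k : ℕ) : ℝ :=
  1 / (16 * q.hbar j * r.hbar k) *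
    (q.h j * r.h k * d (j - 1) (k - 1)
      + q.h (j + 1) * r.h k * d (j + 1) (k - 1)
      + 12 * q.hbar j * r.hbar k * d j k
      + q.h j * r.h (k + 1) * d (j - 1) (k + 1)
      + q.h (j + 1) * r.h (k + 1) * d (j + 1) (k + 1))

/-- The corner weights are products of steps, so the one-dimensional inequality applies in one
direction and then in the other. -/
theorem sum_shift2_le (q r : Mesh1) {e : ℕ → ℕ → ℝ} (he : ∀ j k, 0 ≤ e j k)
    (h0 : ∀ k, e 0 k = 0) (hM : ∀ k, e q.M k = 0) (h0' : ∀ j, e j 0 = 0)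
    (hM' : ∀ j, e j r.M = 0) :
    ∑ j ∈ Finset.Ioo 0 q.M, ∑ k ∈ Finset.Ioo 0 r.M,
      (q.h j * r.h k * e (j - 1) (k - 1) + q.h (j + 1) * r.h k * e (j + 1) (k - 1)
        + q.h j * r.h (k + 1) * e (j - 1) (k + 1) + q.h (j + 1) * r.h (k + 1) * e (j + 1) (k + 1))
      ≤ ∑ j ∈ Finset.Ioo 0 q.M, ∑ k ∈ Finset.Ioo 0 r.M,
        4 * q.hbar j * r.hbar k * e j k := by
  have hr : ∀ k ∈ Finset.Ioo 0 r.M, 0 < r.h k ∧ 0 < r.h (k + 1) := fun k hk =>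
    ⟨r.h_pos (Finset.mem_Ioo.1 hk).1 (Finset.mem_Ioo.1 hk).2.le,
      r.h_succ_pos (Finset.mem_Ioo.1 hk).2⟩
  set s : ℕ → ℝ := fun j =>
    ∑ k ∈ Finset.Ioo 0 r.M, (r.h k * e j (k - 1) + r.h (k + 1) * e j (k + 1)) with hs
  have hs0 : ∀ j, 0 ≤ s j := fun j => Finset.sum_nonneg fun k hk =>
    add_nonneg (mul_nonneg (hr k hk).1.le (he _ _)) (mul_nonneg (hr k hk).2.le (he _ _))
  calc _ = ∑ j ∈ Finset.Ioo 0 q.M, (q.h j * s (j - 1) + q.h (j + 1) * s (j + 1)) := by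
        refine Finset.sum_congr rfl fun j _ => ?_
        rw [hs, Finset.mul_sum, Finset.mul_sum, ← Finset.sum_add_distrib]
        exact Finset.sum_congr rfl fun k _ => by ring
    _ ≤ ∑ j ∈ Finset.Ioo 0 q.M, (q.h j + q.h (j + 1)) * s j :=
        q.sum_shift_le hs0 (by simp [hs, h0]) (by simp [hs, hM])
    _ ≤ ∑ j ∈ Finset.Ioo 0 q.M, (q.h j + q.h (j + 1)) *
          ∑ k ∈ Finset.Ioo 0 r.M, (r.h k + r.h (k + 1)) * e j k := by
        refine Finset.sum_le_sum fun j hj => ?_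
        rw [Finset.mem_Ioo] at hj
        exact mul_le_mul_of_nonneg_left (r.sum_shift_le (he j) (h0' j) (hM' j))
          (add_pos (q.h_pos hj.1 hj.2.le) (q.h_succ_pos hj.2)).le
    _ = _ := by
        refine Finset.sum_congr rfl fun j _ => ?_
        rw [Finset.mul_sum]
        refine Finset.sum_congr rfl fun k _ => ?_
        rw [Mesh1.hbar, Mesh1.hbar]
        ring

theorem sum_mu2_mul_ge (q r : Mesh1) {d : ℕ → ℕ → ℝ}
    (h0 : ∀ k, d 0 k = 0) (hM : ∀ k, d q.M k = 0) (h0' : ∀ j, d j 0 = 0)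
    (hM' : ∀ j, d j r.M = 0) :
    1 / 2 * ∑ j ∈ Finset.Ioo 0 q.M, ∑ k ∈ Finset.Ioo 0 r.M, q.hbar j * r.hbar k * d j k ^ 2
      ≤ ∑ j ∈ Finset.Ioo 0 q.M, ∑ k ∈ Finset.Ioo 0 r.M,
        q.hbar j * r.hbar k * (mu2 q r d j k * d j k) := by
  have h := sum_shift2_le q r (e := fun j k => d j k ^ 2) (fun _ _ => sq_nonneg _)
    (by simp [h0]) (by simp [hM]) (by simp [h0']) (by simp [hM'])
  -- Each corner product is bounded below by `ab ≥ -(a² + b²) / 2`. The corner weights add up to `4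
  -- ħ_j ħ_k`, so the diagonal keeps `12/16 - 4/32 = 5/8`; the shifted squares later cost another
  -- `4/32`, which leaves `1/2`.
  have hterm : ∀ j ∈ Finset.Ioo 0 q.M, ∀ k ∈ Finset.Ioo 0 r.M,
      5 / 8 * (q.hbar j * r.hbar k * d j k ^ 2) - 1 / 32 *
        (q.h j * r.h k * d (j - 1) (k - 1) ^ 2 + q.h (j + 1) * r.h k * d (j + 1) (k - 1) ^ 2
        + q.h j * r.h (k + 1) * d (j - 1) (k + 1) ^ 2
        + q.h (j + 1) * r.h (k + 1) * d (j + 1) (k + 1) ^ 2)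
      ≤ q.hbar j * r.hbar k * (mu2 q r d j k * d j k) := by
    intro j hj k hk
    rw [Finset.mem_Ioo] at hj hk
    have hj1 := q.h_pos hj.1 hj.2.le
    have hj2 := q.h_succ_pos hj.2
    have hk1 := r.h_pos hk.1 hk.2.le
    have hk2 := r.h_succ_pos hk.2
    have hq := (q.hbar_pos hj.1 hj.2).ne'
    have hr := (r.hbar_pos hk.1 hk.2).ne'
    have hmu : q.hbar j * r.hbar k * (mu2 q r d j k * d j k) = 1 / 16 *
        (q.h j * r.h k * d (j - 1) (k - 1)
          + q.h (j + 1) * r.h k * d (j + 1) (k - 1)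
          + 12 * q.hbar j * r.hbar k * d j k
          + q.h j * r.h (k + 1) * d (j - 1) (k + 1)
          + q.h (j + 1) * r.h (k + 1) * d (j + 1) (k + 1)) * d j k := by
      rw [mu2]
      field_simp
    rw [hmu, Mesh1.hbar, Mesh1.hbar]
    nlinarith [mul_nonneg (mul_pos hj1 hk1).le (sq_nonneg (d (j - 1) (k - 1) + d j k)),
      mul_nonneg (mul_pos hj2 hk1).le (sq_nonneg (d (j + 1) (k - 1) + d j k)),
      mul_nonneg (mul_pos hj1 hk2).le (sq_nonneg (d (j - 1) (k + 1) + d j k)),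
      mul_nonneg (mul_pos hj2 hk2).le (sq_nonneg (d (j + 1) (k + 1) + d j k))]
  have hsum := Finset.sum_le_sum fun j hj => Finset.sum_le_sum fun k hk => hterm j hj k hk
  refine le_trans ?_ hsum
  simp only [Finset.sum_sub_distrib, ← Finset.mul_sum, mul_assoc] at h ⊢
  linarith

/-! ### Coercivity of the scheme -/

/-- The second divided difference in the first variable of the average in the other two. -/
noncomputable def stencil (p q r : Mesh1) (v : ℕ → ℕ → ℕ → ℝ) (i j k : ℕ) : ℝ :=
  ((mu2 q r (v (i + 1)) j k - mu2 q r (v i) j k) / p.h (i + 1)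
    - (mu2 q r (v i) j k - mu2 q r (v (i - 1)) j k) / p.h i) / p.hbar i

/-- The squared norm of the divided difference in the first variable. -/
noncomputable def energy3 (p q r : Mesh1) (v : ℕ → ℕ → ℕ → ℝ) : ℝ :=
  ∑ i ∈ Finset.Ioc 0 p.M, ∑ j ∈ Finset.Ioo 0 q.M, ∑ k ∈ Finset.Ioo 0 r.M,
    p.h i * q.hbar j * r.hbar k * ((v i j k - v (i - 1) j k) / p.h i)
      * ((v i j k - v (i - 1) j k) / p.h i)

theorem sum_comm3 (s t u : Finset ℕ) (g : ℕ → ℕ → ℕ → ℝ) :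
    ∑ i ∈ s, ∑ j ∈ t, ∑ k ∈ u, g i j k = ∑ j ∈ t, ∑ k ∈ u, ∑ i ∈ s, g i j k := by
  rw [Finset.sum_comm]
  exact Finset.sum_congr rfl fun j _ => Finset.sum_comm

theorem mu2_sub_div (q r : Mesh1) (d e : ℕ → ℕ → ℝ) (c : ℝ) (j k : ℕ) :
    (mu2 q r d j k - mu2 q r e j k) / c = mu2 q r (fun j k => (d j k - e j k) / c) j k := by
  simp only [mu2]
  ring

/-- Summation by parts in the first variable leaves the averaged difference quotient against the
quotient itself; the lower bound for the averaging applies in each slice of fixed `i`. -/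
theorem half_energy3_le (p q r : Mesh1) {v : ℕ → ℕ → ℕ → ℝ}
    (hi0 : ∀ j k, v 0 j k = 0) (hiM : ∀ j k, v p.M j k = 0)
    (hj0 : ∀ i k, v i 0 k = 0) (hjM : ∀ i k, v i q.M k = 0)
    (hk0 : ∀ i j, v i j 0 = 0) (hkM : ∀ i j, v i j r.M = 0) :
    1 / 2 * energy3 p q r v ≤
      -∑ i ∈ Finset.Ioo 0 p.M, ∑ j ∈ Finset.Ioo 0 q.M, ∑ k ∈ Finset.Ioo 0 r.M,
        p.hbar i * q.hbar j * r.hbar k * stencil p q r v i j k * v i j k := by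
  set V : ℕ → ℕ → ℕ → ℝ := fun i j k =>
    (mu2 q r (v i) j k - mu2 q r (v (i - 1)) j k) / p.h i with hV
  have h1 : -∑ i ∈ Finset.Ioo 0 p.M, ∑ j ∈ Finset.Ioo 0 q.M, ∑ k ∈ Finset.Ioo 0 r.M,
        p.hbar i * q.hbar j * r.hbar k * stencil p q r v i j k * v i j k
      = ∑ i ∈ Finset.Ioc 0 p.M, ∑ j ∈ Finset.Ioo 0 q.M, ∑ k ∈ Finset.Ioo 0 r.M,
        q.hbar j * r.hbar k * (V i j k * (v i j k - v (i - 1) j k)) := by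
    rw [sum_comm3, sum_comm3 (Finset.Ioc 0 p.M), ← Finset.sum_neg_distrib]
    refine Finset.sum_congr rfl fun j _ => ?_
    rw [← Finset.sum_neg_distrib]
    refine Finset.sum_congr rfl fun k _ => ?_
    rw [← Finset.mul_sum, ← neg_eq_iff_eq_neg.2 (p.sum_sub_mul (fun i => V i j k)
      (v := fun i => v i j k) (hi0 j k) (hiM j k)), mul_neg, Finset.mul_sum]
    congr 1
    refine Finset.sum_congr rfl fun i hi => ?_
    have hb := (p.hbar_pos (Finset.mem_Ioo.1 hi).1 (Finset.mem_Ioo.1 hi).2).ne'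
    simp only [stencil, hV, Nat.add_sub_cancel]
    field_simp
  rw [h1, energy3, Finset.mul_sum]
  refine Finset.sum_le_sum fun i hi => ?_
  have hp := p.h_pos (Finset.mem_Ioc.1 hi).1 (Finset.mem_Ioc.1 hi).2
  have h2 := sum_mu2_mul_ge q r (d := fun j k => (v i j k - v (i - 1) j k) / p.h i)
    (by simp [hj0]) (by simp [hjM]) (by simp [hk0]) (by simp [hkM])
  have h3 := mul_le_mul_of_nonneg_left h2 hp.le
  refine le_trans (le_of_eq ?_) (h3.trans (le_of_eq ?_))
  · simp only [Finset.mul_sum]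
    exact Finset.sum_congr rfl fun j _ => Finset.sum_congr rfl fun k _ => by ring
  · rw [Finset.mul_sum]
    refine Finset.sum_congr rfl fun j _ => ?_
    rw [Finset.mul_sum]
    refine Finset.sum_congr rfl fun k _ => ?_
    simp only [hV]
    rw [mu2_sub_div]
    field_simp

theorem sum_sq_le_energy3 (p q r : Mesh1) {v : ℕ → ℕ → ℕ → ℝ}
    (hi0 : ∀ j k, v 0 j k = 0) (hiM : ∀ j k, v p.M j k = 0) :
    ∑ i ∈ Finset.Ioo 0 p.M, ∑ j ∈ Finset.Ioo 0 q.M, ∑ k ∈ Finset.Ioo 0 r.M,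
      p.hbar i * q.hbar j * r.hbar k * v i j k * v i j k ≤ 1 / 6 * energy3 p q r v := by
  rw [energy3, sum_comm3, sum_comm3 (Finset.Ioc 0 p.M), Finset.mul_sum]
  refine Finset.sum_le_sum fun j hj => ?_
  rw [Finset.mul_sum]
  refine Finset.sum_le_sum fun k hk => ?_
  have hq := q.hbar_pos (Finset.mem_Ioo.1 hj).1 (Finset.mem_Ioo.1 hj).2
  have hr := r.hbar_pos (Finset.mem_Ioo.1 hk).1 (Finset.mem_Ioo.1 hk).2
  have h := mul_le_mul_of_nonneg_left
    (p.sum_hbar_mul_sq_le (v := fun i => v i j k) (hi0 j k) (hiM j k)) (mul_pos hq hr).le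
  refine le_trans (le_of_eq ?_) (h.trans (le_of_eq ?_))
  · rw [Finset.mul_sum]
    exact Finset.sum_congr rfl fun i _ => by ring
  · rw [Mesh1.energy, mul_left_comm, Finset.mul_sum]
    congr 1
    exact Finset.sum_congr rfl fun i _ => by ring

namespace Mesh

variable (m : Mesh)

/-- The difference operator of the scheme. -/
noncomputable def operator (v : ℕ → ℕ → ℕ → ℝ) (i j k : ℕ) : ℝ :=
  -2 * (m.dPlusX (m.dMinusX (m.muYZ v)) i j k + m.dPlusY (m.dMinusY (m.muXZ v)) i j k
    + m.dPlusZ (m.dMinusZ (m.muXY v)) i j k)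

/-- Reduces the three directions to one stencil with permuted variables. -/
theorem operator_eq (v : ℕ → ℕ → ℕ → ℝ) (i j k : ℕ) :
    m.operator v i j k = -2 * (stencil m.x m.y m.z v i j k
      + stencil m.y m.x m.z (fun j i k => v i j k) j i k
      + stencil m.z m.x m.y (fun k i j => v i j k) k i j) := rfl

/-- The function vanishes outside the interior mesh points. -/
def IsInterior (v : ℕ → ℕ → ℕ → ℝ) : Prop := ∀ i j k, ¬ m.Interior i j k → v i j k = 0

theorem innerX_dMinusX (v : ℕ → ℕ → ℕ → ℝ) :
    m.innerX (m.dMinusX v) (m.dMinusX v) = energy3 m.x m.y m.z v := rfl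

theorem innerY_dMinusY (v : ℕ → ℕ → ℕ → ℝ) :
    m.innerY (m.dMinusY v) (m.dMinusY v) = energy3 m.y m.x m.z (fun j i k => v i j k) := by
  rw [innerY, energy3, Finset.sum_comm]
  refine Finset.sum_congr rfl fun j _ => Finset.sum_congr rfl fun i _ =>
    Finset.sum_congr rfl fun k _ => ?_
  simp only [dMinusY]
  ring

theorem innerZ_dMinusZ (v : ℕ → ℕ → ℕ → ℝ) :
    m.innerZ (m.dMinusZ v) (m.dMinusZ v) = energy3 m.z m.x m.y (fun k i j => v i j k) := by
  rw [innerZ, energy3, sum_comm3 (Finset.Ioc 0 m.z.M)]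
  refine Finset.sum_congr rfl fun i _ => Finset.sum_congr rfl fun j _ =>
    Finset.sum_congr rfl fun k _ => ?_
  simp only [dMinusZ]
  ring

theorem energy3_nonneg (p q r : Mesh1) (v : ℕ → ℕ → ℕ → ℝ) : 0 ≤ energy3 p q r v := by
  refine Finset.sum_nonneg fun i hi => Finset.sum_nonneg fun j hj => Finset.sum_nonneg fun k hk => ?_
  rw [mul_assoc]
  have hp := p.h_pos (Finset.mem_Ioc.1 hi).1 (Finset.mem_Ioc.1 hi).2
  have hq := q.hbar_pos (Finset.mem_Ioo.1 hj).1 (Finset.mem_Ioo.1 hj).2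
  have hr := r.hbar_pos (Finset.mem_Ioo.1 hk).1 (Finset.mem_Ioo.1 hk).2
  exact mul_nonneg (by positivity) (mul_self_nonneg _)

theorem weight_pos {i j k : ℕ} (h : m.Interior i j k) :
    0 < m.x.hbar i * m.y.hbar j * m.z.hbar k :=
  mul_pos (mul_pos (m.x.hbar_pos h.1.1 h.1.2) (m.y.hbar_pos h.2.1.1 h.2.1.2))
    (m.z.hbar_pos h.2.2.1 h.2.2.2)

theorem interior_of_mem {i j k : ℕ} (hi : i ∈ Finset.Ioo 0 m.x.M) (hj : j ∈ Finset.Ioo 0 m.y.M)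
    (hk : k ∈ Finset.Ioo 0 m.z.M) : m.Interior i j k :=
  ⟨Finset.mem_Ioo.1 hi, Finset.mem_Ioo.1 hj, Finset.mem_Ioo.1 hk⟩

theorem innerL2_self_nonneg (v : ℕ → ℕ → ℕ → ℝ) : 0 ≤ m.innerL2 v v := by
  refine Finset.sum_nonneg fun i hi => Finset.sum_nonneg fun j hj => Finset.sum_nonneg fun k hk => ?_
  rw [mul_assoc]
  exact mul_nonneg (m.weight_pos (m.interior_of_mem hi hj hk)).le (mul_self_nonneg _)

theorem innerL2_congr {v v' : ℕ → ℕ → ℕ → ℝ} (w : ℕ → ℕ → ℕ → ℝ)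
    (h : ∀ i j k, m.Interior i j k → v i j k = v' i j k) : m.innerL2 v w = m.innerL2 v' w :=
  Finset.sum_congr rfl fun i hi => Finset.sum_congr rfl fun j hj =>
    Finset.sum_congr rfl fun k hk => by rw [h i j k (m.interior_of_mem hi hj hk)]

theorem sq_innerL2_le (v w : ℕ → ℕ → ℕ → ℝ) :
    m.innerL2 v w ^ 2 ≤ m.innerL2 v v * m.innerL2 w w := by
  have h : ∀ v w, m.innerL2 v w = ∑ a ∈ Finset.Ioo 0 m.x.M ×ˢ Finset.Ioo 0 m.y.M ×ˢ
      Finset.Ioo 0 m.z.M, m.x.hbar a.1 * m.y.hbar a.2.1 * m.z.hbar a.2.2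
        * v a.1 a.2.1 a.2.2 * w a.1 a.2.1 a.2.2 := fun v w => by
    simp only [innerL2, Finset.sum_product]
  have hpos : ∀ a ∈ Finset.Ioo 0 m.x.M ×ˢ Finset.Ioo 0 m.y.M ×ˢ Finset.Ioo 0 m.z.M,
      0 < m.x.hbar a.1 * m.y.hbar a.2.1 * m.z.hbar a.2.2 := fun a ha => by
    simp only [Finset.mem_product] at ha
    exact m.weight_pos (m.interior_of_mem ha.1 ha.2.1 ha.2.2)
  rw [h, h, h]
  refine Finset.sum_sq_le_sum_mul_sum_of_sq_le_mul _ (fun a ha => ?_) (fun a ha => ?_)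
    fun a _ => le_of_eq (by ring)
  all_goals
    rw [mul_assoc]
    exact mul_nonneg (hpos a ha).le (mul_self_nonneg _)

theorem normL2_sq (v : ℕ → ℕ → ℕ → ℝ) : m.normL2 v ^ 2 = m.innerL2 v v :=
  Real.sq_sqrt (m.innerL2_self_nonneg v)

theorem seminormH1_sq (v : ℕ → ℕ → ℕ → ℝ) : m.seminormH1 v ^ 2 =
    energy3 m.x m.y m.z v + energy3 m.y m.x m.z (fun j i k => v i j k)
      + energy3 m.z m.x m.y (fun k i j => v i j k) := by
  rw [seminormH1, innerX_dMinusX, innerY_dMinusY, innerZ_dMinusZ, Real.sq_sqrt]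
  exact add_nonneg (add_nonneg (energy3_nonneg _ _ _ _) (energy3_nonneg _ _ _ _))
    (energy3_nonneg _ _ _ _)

theorem normH1_sq (v : ℕ → ℕ → ℕ → ℝ) :
    m.normH1 v ^ 2 = m.normL2 v ^ 2 + m.seminormH1 v ^ 2 :=
  Real.sq_sqrt (by positivity)

variable {m}

theorem IsInterior.seminormH1_sq_le {v : ℕ → ℕ → ℕ → ℝ} (hv : m.IsInterior v) :
    m.seminormH1 v ^ 2 ≤ m.innerL2 (m.operator v) v := by
  have h : ∀ i j k, i = 0 ∨ i = m.x.M ∨ j = 0 ∨ j = m.y.M ∨ k = 0 ∨ k = m.z.M → v i j k = 0 :=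
    fun i j k hijk => hv i j k fun ⟨h1, h2, h3⟩ => by omega
  have hx := half_energy3_le m.x m.y m.z (v := v) (fun _ _ => h _ _ _ (by simp))
    (fun _ _ => h _ _ _ (by simp)) (fun _ _ => h _ _ _ (by simp)) (fun _ _ => h _ _ _ (by simp))
    (fun _ _ => h _ _ _ (by simp)) (fun _ _ => h _ _ _ (by simp))
  have hy := half_energy3_le m.y m.x m.z (v := fun j i k => v i j k)
    (fun _ _ => h _ _ _ (by simp))
    (fun _ _ => h _ _ _ (by simp)) (fun _ _ => h _ _ _ (by simp)) (fun _ _ => h _ _ _ (by simp))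
    (fun _ _ => h _ _ _ (by simp)) (fun _ _ => h _ _ _ (by simp))
  have hz := half_energy3_le m.z m.x m.y (v := fun k i j => v i j k)
    (fun _ _ => h _ _ _ (by simp))
    (fun _ _ => h _ _ _ (by simp)) (fun _ _ => h _ _ _ (by simp)) (fun _ _ => h _ _ _ (by simp))
    (fun _ _ => h _ _ _ (by simp)) (fun _ _ => h _ _ _ (by simp))
  rw [Finset.sum_comm] at hy
  rw [sum_comm3 (Finset.Ioo 0 m.z.M)] at hz
  have hsum : m.innerL2 (m.operator v) v =
      2 * -(∑ i ∈ Finset.Ioo 0 m.x.M, ∑ j ∈ Finset.Ioo 0 m.y.M, ∑ k ∈ Finset.Ioo 0 m.z.M,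
        m.x.hbar i * m.y.hbar j * m.z.hbar k * stencil m.x m.y m.z v i j k * v i j k)
      + 2 * -(∑ i ∈ Finset.Ioo 0 m.x.M, ∑ j ∈ Finset.Ioo 0 m.y.M, ∑ k ∈ Finset.Ioo 0 m.z.M,
        m.y.hbar j * m.x.hbar i * m.z.hbar k
          * stencil m.y m.x m.z (fun j i k => v i j k) j i k * v i j k)
      + 2 * -(∑ i ∈ Finset.Ioo 0 m.x.M, ∑ j ∈ Finset.Ioo 0 m.y.M, ∑ k ∈ Finset.Ioo 0 m.z.M,
        m.z.hbar k * m.x.hbar i * m.y.hbar j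
          * stencil m.z m.x m.y (fun k i j => v i j k) k i j * v i j k) := by
    simp only [innerL2, operator_eq, mul_neg, ← Finset.sum_neg_distrib, Finset.mul_sum,
      ← Finset.sum_add_distrib]
    refine Finset.sum_congr rfl fun i _ => Finset.sum_congr rfl fun j _ =>
      Finset.sum_congr rfl fun k _ => by ring
  rw [seminormH1_sq, hsum]
  linarith

/-- Adding the Friedrichs inequalities of the three directions bounds three copies of the left side
by `1/6` of the full energy. -/
theorem IsInterior.normL2_sq_le {v : ℕ → ℕ → ℕ → ℝ} (hv : m.IsInterior v) :
    m.normL2 v ^ 2 ≤ 1 / 18 * m.seminormH1 v ^ 2 := by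
  have hx := sum_sq_le_energy3 m.x m.y m.z (v := v)
    (fun _ _ => hv _ _ _ fun h => by have := h.1; omega)
    (fun _ _ => hv _ _ _ fun h => by have := h.1; omega)
  have hy := sum_sq_le_energy3 m.y m.x m.z (v := fun j i k => v i j k)
    (fun _ _ => hv _ _ _ fun h => by have := h.2.1; omega)
    (fun _ _ => hv _ _ _ fun h => by have := h.2.1; omega)
  have hz := sum_sq_le_energy3 m.z m.x m.y (v := fun k i j => v i j k)
    (fun _ _ => hv _ _ _ fun h => by have := h.2.2; omega)
    (fun _ _ => hv _ _ _ fun h => by have := h.2.2; omega)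
  rw [Finset.sum_comm] at hy
  rw [sum_comm3 (Finset.Ioo 0 m.z.M)] at hz
  have hy' : m.innerL2 v v ≤ 1 / 6 * energy3 m.y m.x m.z (fun j i k => v i j k) := by
    refine le_trans (le_of_eq ?_) hy
    exact Finset.sum_congr rfl fun i _ => Finset.sum_congr rfl fun j _ =>
      Finset.sum_congr rfl fun k _ => by ring
  have hz' : m.innerL2 v v ≤ 1 / 6 * energy3 m.z m.x m.y (fun k i j => v i j k) := by
    refine le_trans (le_of_eq ?_) hz
    exact Finset.sum_congr rfl fun i _ => Finset.sum_congr rfl fun j _ =>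
      Finset.sum_congr rfl fun k _ => by ring
  have hx' : m.innerL2 v v ≤ 1 / 6 * energy3 m.x m.y m.z v := hx
  rw [seminormH1_sq, normL2_sq]
  linarith

theorem IsInterior.normH1_sq_le {v : ℕ → ℕ → ℕ → ℝ} (hv : m.IsInterior v) :
    m.normH1 v ^ 2 ≤ 32 / 30 * m.innerL2 (m.operator v) v := by
  have h1 := hv.seminormH1_sq_le
  have h2 := hv.normL2_sq_le
  have h3 := sq_nonneg (m.seminormH1 v)
  rw [normH1_sq]
  -- The sharper factor obtained is `1 + 1/18 = 19/18`, below `32/30`.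
  linarith

theorem IsInterior.eq_zero {v : ℕ → ℕ → ℕ → ℝ} (hv : m.IsInterior v)
    (h : ∀ i j k, m.Interior i j k → m.operator v i j k = 0) (i j k : ℕ) : v i j k = 0 := by
  by_cases hI : m.Interior i j k
  swap
  · exact hv i j k hI
  have h1 := hv.normH1_sq_le
  have h2 : m.innerL2 (m.operator v) v = 0 :=
    Finset.sum_eq_zero fun i hi => Finset.sum_eq_zero fun j hj => Finset.sum_eq_zero fun k hk => by
      rw [h i j k (m.interior_of_mem hi hj hk)]; ring
  rw [h2, mul_zero, normH1_sq, normL2_sq] at h1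
  have h3 : m.innerL2 v v = 0 :=
    le_antisymm (by linarith [sq_nonneg (m.seminormH1 v)]) (m.innerL2_self_nonneg v)
  have hn : ∀ i ∈ Finset.Ioo 0 m.x.M, ∀ j ∈ Finset.Ioo 0 m.y.M, ∀ k ∈ Finset.Ioo 0 m.z.M,
      0 ≤ m.x.hbar i * m.y.hbar j * m.z.hbar k * v i j k * v i j k := fun i hi j hj k hk => by
    rw [mul_assoc]
    exact mul_nonneg (m.weight_pos (m.interior_of_mem hi hj hk)).le (mul_self_nonneg _)
  have hi := Finset.mem_Ioo.2 hI.1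
  have hj := Finset.mem_Ioo.2 hI.2.1
  have hk := Finset.mem_Ioo.2 hI.2.2
  have h4 := (Finset.sum_eq_zero_iff_of_nonneg fun i hi => Finset.sum_nonneg fun j hj =>
    Finset.sum_nonneg fun k hk => hn i hi j hj k hk).1 h3 i hi
  have h5 := (Finset.sum_eq_zero_iff_of_nonneg fun j hj =>
    Finset.sum_nonneg fun k hk => hn i hi j hj k hk).1 h4 j hj
  have h6 := (Finset.sum_eq_zero_iff_of_nonneg fun k hk => hn i hi j hj k hk).1 h5 k hk
  rw [mul_assoc] at h6
  exact mul_self_eq_zero.1 ((mul_eq_zero.1 h6).resolve_left (m.weight_pos hI).ne')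

/-! ### Unique solvability and stability -/

theorem Fn.VanishesOnBoundary.isInterior {u : m.Fn} (hu : u.VanishesOnBoundary) :
    m.IsInterior u.val := by
  intro i j k h
  by_cases hijk : i < m.x.M + 1 ∧ j < m.y.M + 1 ∧ k < m.z.M + 1
  · exact hu i (by omega) j (by omega) k (by omega) h
  · exact dif_neg hijk

theorem Fn.val_apply (u : m.Fn) (i : Fin (m.x.M + 1)) (j : Fin (m.y.M + 1))
    (k : Fin (m.z.M + 1)) : u.val i j k = u i j k :=
  dif_pos ⟨i.2, j.2, k.2⟩

theorem Fn.val_add (u w : m.Fn) (i j k : ℕ) : (u + w).val i j k = u.val i j k + w.val i j k := by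
  simp only [Fn.val]
  split_ifs <;> simp

theorem Fn.val_smul (c : ℝ) (u : m.Fn) (i j k : ℕ) : (c • u).val i j k = c * u.val i j k := by
  simp only [Fn.val]
  split_ifs <;> simp

open Classical in
variable (m) in
/-- The operator of the scheme at interior mesh points, the identity at boundary points. -/
noncomputable def schemeMap : m.Fn →ₗ[ℝ] m.Fn where
  toFun u i j k := if m.Interior i j k then m.operator u.val i j k else u i j k
  map_add' u w := by
    funext i j k
    simp only [Pi.add_apply]
    split_ifs with h
    · simp only [operator_eq, stencil, mu2, Fn.val_add]
      ring
    · rfl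
  map_smul' c u := by
    funext i j k
    simp only [Pi.smul_apply, RingHom.id_apply, smul_eq_mul]
    split_ifs with h
    · simp only [operator_eq, stencil, mu2, Fn.val_smul]
      ring
    · rfl

theorem schemeMap_of_interior (u : m.Fn) {i j k : ℕ} (h : m.Interior i j k) :
    (m.schemeMap u).val i j k = m.operator u.val i j k := by
  obtain ⟨h1, h2, h3⟩ := h
  rw [Fn.val, dif_pos ⟨by omega, by omega, by omega⟩]
  exact if_pos ⟨h1, h2, h3⟩

theorem schemeMap_of_not_interior (u : m.Fn) {i j k : ℕ} (h : ¬ m.Interior i j k) :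
    (m.schemeMap u).val i j k = u.val i j k := by
  simp only [Fn.val]
  split_ifs
  · exact if_neg h
  · rfl

theorem Fn.eq_of_val_eq {u w : m.Fn} (h : ∀ i j k, u.val i j k = w.val i j k) : u = w := by
  funext i j k
  rw [← Fn.val_apply u, ← Fn.val_apply w, h]

theorem Fn.val_zero (i j k : ℕ) : (0 : m.Fn).val i j k = 0 := by
  simp [Fn.val]

/-- The identity rows force a kernel element to vanish on the boundary, after which coercivity
applies. -/
theorem schemeMap_injective : Function.Injective m.schemeMap := by
  rw [← LinearMap.ker_eq_bot, LinearMap.ker_eq_bot']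
  intro u hu
  have hval : ∀ i j k, (m.schemeMap u).val i j k = 0 := fun i j k => by rw [hu, Fn.val_zero]
  have hI : m.IsInterior u.val := fun i j k h => by rw [← schemeMap_of_not_interior u h, hval]
  refine Fn.eq_of_val_eq fun i j k => ?_
  rw [Fn.val_zero]
  exact hI.eq_zero (fun i j k h => by rw [← schemeMap_of_interior u h, hval]) i j k

theorem existsUnique_solution (T : ℕ → ℕ → ℕ → ℝ) :
    ∃! u : m.Fn, (∀ i j k, m.Interior i j k → m.operator u.val i j k = T i j k) ∧
      u.VanishesOnBoundary := by
  classical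
  set b : m.Fn := fun i j k => if m.Interior i j k then T i j k else 0 with hb
  have hbI : ∀ i j k, m.Interior i j k → b.val i j k = T i j k := by
    rintro i j k ⟨h1, h2, h3⟩
    rw [Fn.val, dif_pos ⟨by omega, by omega, by omega⟩]
    exact if_pos ⟨h1, h2, h3⟩
  have hbB : ∀ i j k, ¬ m.Interior i j k → b.val i j k = 0 := by
    intro i j k h
    simp only [Fn.val]
    split_ifs
    · exact if_neg h
    · rfl
  have key : ∀ u : m.Fn, m.schemeMap u = b ↔
      ((∀ i j k, m.Interior i j k → m.operator u.val i j k = T i j k) ∧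
        u.VanishesOnBoundary) := by
    intro u
    constructor
    · intro h
      refine ⟨fun i j k hI => ?_, fun i _ j _ k _ hI => ?_⟩
      · rw [← schemeMap_of_interior u hI, h, hbI i j k hI]
      · rw [← schemeMap_of_not_interior u hI, h, hbB i j k hI]
    · rintro ⟨h1, h2⟩
      refine Fn.eq_of_val_eq fun i j k => ?_
      by_cases hI : m.Interior i j k
      · rw [schemeMap_of_interior u hI, h1 i j k hI, hbI i j k hI]
      · rw [schemeMap_of_not_interior u hI, h2.isInterior i j k hI, hbB i j k hI]
  -- Existence from uniqueness: an injective endomorphism of a finite-dimensional space is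
  -- surjective.
  obtain ⟨u, hu⟩ := LinearMap.injective_iff_surjective.1 schemeMap_injective b
  exact ⟨u, (key u).1 hu, fun w hw => schemeMap_injective (((key w).2 hw).trans hu.symm)⟩

theorem normH1_nonneg (v : ℕ → ℕ → ℕ → ℝ) : 0 ≤ m.normH1 v := Real.sqrt_nonneg _

theorem normHneg1_nonneg (v : ℕ → ℕ → ℕ → ℝ) : 0 ≤ m.normHneg1 v :=
  Real.iSup_nonneg fun _ => div_nonneg (abs_nonneg _) (normH1_nonneg _)

theorem abs_innerL2_le (v w : ℕ → ℕ → ℕ → ℝ) :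
    |m.innerL2 v w| ≤ m.normL2 v * m.normH1 w := by
  refine abs_le_of_sq_le_sq ?_ (mul_nonneg (Real.sqrt_nonneg _) (normH1_nonneg _))
  rw [mul_pow, normL2_sq, normH1_sq, normL2_sq]
  exact (m.sq_innerL2_le v w).trans (mul_le_mul_of_nonneg_left
    (le_add_of_nonneg_right (sq_nonneg _)) (m.innerL2_self_nonneg v))

/-- An unbounded real supremum would take the default value `0`; boundedness lets each quotient be
compared with it. -/
theorem bddAbove_normHneg1 (v : ℕ → ℕ → ℕ → ℝ) :
    BddAbove (Set.range fun w : {w : m.Fn // w ≠ 0 ∧ w.VanishesOnBoundary} =>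
      |m.innerL2 v w.1.val| / m.normH1 w.1.val) := by
  refine ⟨m.normL2 v, ?_⟩
  rintro _ ⟨w, rfl⟩
  exact div_le_of_le_mul₀ (normH1_nonneg _) (Real.sqrt_nonneg _) (abs_innerL2_le _ _)

theorem normH1_le_normHneg1 {T : ℕ → ℕ → ℕ → ℝ} {u : m.Fn}
    (h : ∀ i j k, m.Interior i j k → m.operator u.val i j k = T i j k)
    (hu : u.VanishesOnBoundary) : m.normH1 u.val ≤ 32 / 30 * m.normHneg1 T := by
  have hn := normHneg1_nonneg (m := m) T
  have h1 := hu.isInterior.normH1_sq_le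
  rw [innerL2_congr m _ h] at h1
  rcases (normH1_nonneg (m := m) u.val).eq_or_lt with h0 | h0
  · rw [← h0]
    positivity
  have hne : u ≠ 0 := by
    rintro rfl
    have hz : m.innerL2 T (0 : m.Fn).val = 0 := by simp [innerL2, Fn.val_zero]
    rw [hz, mul_zero] at h1
    exact absurd (pow_pos h0 2) (not_lt.2 h1)
  -- The solution itself is the test function in the supremum.
  have h2 : |m.innerL2 T u.val| / m.normH1 u.val ≤ m.normHneg1 T :=
    le_ciSup (bddAbove_normHneg1 (m := m) T) ⟨u, hne, hu⟩
  rw [div_le_iff₀ h0] at h2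
  have h3 := le_abs_self (m.innerL2 T u.val)
  have h4 : m.normH1 u.val * m.normH1 u.val ≤ 32 / 30 * m.normHneg1 T * m.normH1 u.val := by
    rw [← sq]
    linarith
  exact le_of_mul_le_mul_right h4 h0

/-! ### The convolution with the kernels of the cells -/

variable (m)

/-- The lower corner of the intersection of the cube with the shifted cell. -/
noncomputable def lowerCorner (i j k : ℕ) (x : E3) : Fin 3 → ℝ :=
  fun l => max 0 (x l - (m.node i j k) l +
    ![m.x.pt i - m.x.h i / 2, m.y.pt j - m.y.h j / 2, m.z.pt k - m.z.h k / 2] l)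

/-- The upper corner of the intersection of the cube with the shifted cell. -/
noncomputable def upperCorner (i j k : ℕ) (x : E3) : Fin 3 → ℝ :=
  fun l => min 1 (x l - (m.node i j k) l +
    ![m.x.pt i + m.x.h (i + 1) / 2, m.y.pt j + m.y.h (j + 1) / 2,
      m.z.pt k + m.z.h (k + 1) / 2] l)

/-- The set is the cell translated by `x - (x_i, y_j, z_k)` and cut off by the cube, hence a box for
every `x`, possibly empty. -/
theorem convSet_kernel (i j k : ℕ) (x : E3) :
    convSet (m.kernel i j k) x = box (m.lowerCorner i j k x) (m.upperCorner i j k x) := by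
  ext y
  have h1 : y ∈ unitCube ↔ ∀ l, 0 < y l ∧ y l < 1 := Iff.rfl
  simp only [convSet, kernel, cell, Mesh1.cell, box, lowerCorner, upperCorner, Set.mem_ofPred_eq,
    h1, Set.mem_Ioo, Fin.forall_fin_succ, max_lt_iff, lt_min_iff, PiLp.sub_apply]
  simp
  constructor
  · rintro ⟨⟨⟨a1, a2⟩, ⟨b1, b2⟩, c1, c2⟩, ⟨a3, a4⟩, ⟨b3, b4⟩, c3, c4⟩
    refine ⟨⟨⟨?_, ?_⟩, ?_, ?_⟩, ⟨⟨?_, ?_⟩, ?_, ?_⟩, ⟨?_, ?_⟩, ?_, ?_⟩ <;> linarith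
  · rintro ⟨⟨⟨a1, a2⟩, a3, a4⟩, ⟨⟨b1, b2⟩, b3, b4⟩, ⟨c1, c2⟩, c3, c4⟩
    refine ⟨⟨⟨?_, ?_⟩, ⟨?_, ?_⟩, ?_, ?_⟩, ⟨?_, ?_⟩, ⟨?_, ?_⟩, ?_, ?_⟩ <;> linarith

theorem lowerCorner_nonneg (i j k : ℕ) (x : E3) : 0 ≤ m.lowerCorner i j k x :=
  fun _ => le_max_left _ _

theorem upperCorner_le_one (i j k : ℕ) (x : E3) : m.upperCorner i j k x ≤ 1 :=
  fun _ => min_le_left _ _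

theorem continuous_lowerCorner (i j k : ℕ) : Continuous (m.lowerCorner i j k) := by
  unfold lowerCorner
  fun_prop

theorem continuous_upperCorner (i j k : ℕ) : Continuous (m.upperCorner i j k) := by
  unfold upperCorner
  fun_prop

/-- `limUnder` is additive only where the limits exist, which membership in `H^σ` guarantees. -/
theorem T111_linear {σ : ℝ} (hσ : -1 / 2 < σ) {f g : 𝓓'(unitCube, ℝ)}
    (hf : MemSobolevCube σ f) (hg : MemSobolevCube σ g) (a b : ℝ) (i j k : ℕ) :
    m.T111 (a • f + b • g) i j k = a * m.T111 f i j k + b * m.T111 g i j k := by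
  set x := m.node i j k
  have h0 := m.lowerCorner_nonneg i j k x
  have h1 := m.upperCorner_le_one i j k x
  have hK := m.convSet_kernel i j k x
  obtain ⟨c, hc, -⟩ := existsUnique_hasPairing_box hσ hf h0 h1
  obtain ⟨d, hd, -⟩ := existsUnique_hasPairing_box hσ hg h0 h1
  have hcd : HasPairing (a • f + b • g) (box (m.lowerCorner i j k x) (m.upperCorner i j k x))
      (a * c + b * d) := (Tendsto.const_mul a hc).add (Tendsto.const_mul b hd)
  rw [T111, T111, T111, indicatorConv_eq h0 h1 hK hc, indicatorConv_eq h0 h1 hK hd,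
    indicatorConv_eq h0 h1 hK hcd]
  ring

theorem exists_bound {σ : ℝ} (hσ : -1 / 2 < σ) : ∃ C : ℝ≥0, ∀ f : 𝓓'(unitCube, ℝ),
    ∀ i j k, m.Interior i j k →
      (∀ x, ‖indicatorConv (m.kernel i j k) f x‖ₑ ≤ C * sobolevNormCube σ f) ∧
      ‖m.T111 f i j k‖ₑ ≤ C * sobolevNormCube σ f := by
  -- A sum that dominates the reciprocal volume of every cell. The extra terms with a zero index are
  -- harmless, as all terms are nonnegative.
  set D : ℝ≥0 := ∑ i ∈ Finset.range m.x.M, ∑ j ∈ Finset.range m.y.M, ∑ k ∈ Finset.range m.z.M,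
    ‖1 / (m.x.hbar i * m.y.hbar j * m.z.hbar k)‖₊ with hD
  refine ⟨(1 + D) * convConst σ, fun f i j k hI => ?_⟩
  have hconv : ∀ x, ‖indicatorConv (m.kernel i j k) f x‖ₑ ≤ convConst σ * sobolevNormCube σ f :=
    fun x => enorm_indicatorConv_le hσ f (m.lowerCorner_nonneg i j k x)
      (m.upperCorner_le_one i j k x) (m.convSet_kernel i j k x)
  have hle : ‖1 / (m.x.hbar i * m.y.hbar j * m.z.hbar k)‖₊ ≤ D := by
    have hi := Finset.mem_range.2 hI.1.2
    have hj := Finset.mem_range.2 hI.2.1.2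
    have hk := Finset.mem_range.2 hI.2.2.2
    exact (Finset.single_le_sum (f := fun k => ‖1 / (m.x.hbar i * m.y.hbar j * m.z.hbar k)‖₊)
      (fun _ _ => zero_le) hk).trans ((Finset.single_le_sum (f := fun j =>
        ∑ k ∈ Finset.range m.z.M, ‖1 / (m.x.hbar i * m.y.hbar j * m.z.hbar k)‖₊)
      (fun _ _ => zero_le) hj).trans (Finset.single_le_sum (f := fun i =>
        ∑ j ∈ Finset.range m.y.M, ∑ k ∈ Finset.range m.z.M,
          ‖1 / (m.x.hbar i * m.y.hbar j * m.z.hbar k)‖₊) (fun _ _ => zero_le) hi))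
  rw [ENNReal.coe_mul, mul_assoc]
  refine ⟨fun x => (hconv x).trans (le_mul_of_one_le_left' ?_), ?_⟩
  · rw [ENNReal.coe_add, ENNReal.coe_one]
    exact le_self_add
  · rw [T111, enorm_mul]
    refine mul_le_mul' ?_ (hconv _)
    rw [enorm_eq_nnnorm, ENNReal.coe_le_coe]
    exact hle.trans le_add_self

end Mesh

end FiniteVolume

theorem mainTheorem4 (σ : ℝ) (hσ : -1 / 2 < σ) (m : FiniteVolume.Mesh) :
    -- for data in `H^σ(Ω)` the convolutions with the cell kernels are well defined
    -- (the pairings exist, with one value only) and are continuous functions on `ℝ³`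
    (∀ f : 𝓓'(FiniteVolume.unitCube, ℝ), FiniteVolume.MemSobolevCube σ f →
      ∀ i j k, m.Interior i j k →
        (∀ x, ∃! c, FiniteVolume.HasPairing f (FiniteVolume.convSet (m.kernel i j k) x) c) ∧
        Continuous (FiniteVolume.indicatorConv (m.kernel i j k) f)) ∧
    -- the convolutions and `T₁₁₁` depend linearly and continuously on the data
    (∀ f g : 𝓓'(FiniteVolume.unitCube, ℝ), FiniteVolume.MemSobolevCube σ f →
      FiniteVolume.MemSobolevCube σ g → ∀ a b : ℝ, ∀ i j k, m.Interior i j k →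
        m.T111 (a • f + b • g) i j k = a * m.T111 f i j k + b * m.T111 g i j k) ∧
    (∃ C : ℝ≥0, ∀ f : 𝓓'(FiniteVolume.unitCube, ℝ), FiniteVolume.MemSobolevCube σ f →
      ∀ i j k, m.Interior i j k →
        (∀ x, ‖FiniteVolume.indicatorConv (m.kernel i j k) f x‖ₑ
          ≤ C * FiniteVolume.sobolevNormCube σ f) ∧
        ‖m.T111 f i j k‖ₑ ≤ C * FiniteVolume.sobolevNormCube σ f) ∧
    -- unique solvability and stability of the scheme
    (∀ f : 𝓓'(FiniteVolume.unitCube, ℝ), FiniteVolume.MemSobolevCube σ f →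
      (∃! u : m.Fn, m.IsSolution f u) ∧
      ∀ u : m.Fn, m.IsSolution f u →
        m.normH1 u.val ≤ 32 / 30 * m.normHneg1 (m.T111 f)) := by
  refine ⟨fun f hf i j k _ => ⟨fun x => ?_, ?_⟩,
    fun f g hf hg a b i j k _ => m.T111_linear hσ hf hg a b i j k, ?_,
    fun f _ => ⟨FiniteVolume.Mesh.existsUnique_solution (m.T111 f), fun u hu =>
      FiniteVolume.Mesh.normH1_le_normHneg1 hu.1 hu.2⟩⟩
  · rw [m.convSet_kernel]
    exact FiniteVolume.existsUnique_hasPairing_box hσ hf (m.lowerCorner_nonneg i j k x)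
      (m.upperCorner_le_one i j k x)
  · exact FiniteVolume.continuous_indicatorConv hσ hf (m.lowerCorner_nonneg i j k)
      (m.upperCorner_le_one i j k) (m.continuous_lowerCorner i j k)
      (m.continuous_upperCorner i j k) (m.convSet_kernel i j k)
  · obtain ⟨C, hC⟩ := m.exists_bound hσ
    exact ⟨C, fun f _ => hC f⟩
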